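/- Consider an episodic Markov decision process with a finite set $\mathcal S'$ of $S$ transient states, one absorbing terminal state $\tilde s$, a finite set $\mathcal A$ of $A$ actions, transition probabilities $p(\cdot\mid s,a)$ on $\mathcal S'\cup\{\tilde s\}$ and rewards $r(s,a)\in[0,1]$, in which every (deterministic stationary) policy $\pi:\mathcal S'\to\mathcal A$ is proper, i.e. reaches $\tilde s$ almost surely from every state. For a policy $\pi$ let $q_\pi(s,a)$ be the expected undiscounted sum of rewards up to termination of an episode that starts in $s$, takes action $a$ and follows $\pi$ thereafter, let $v_\pi(s)=q_\pi(s,\pi(s))$, let $q_\star(s,a)=\max_\pi q_\pi(s,a)$, and call $\pi$ optimal if $v_\pi(s)=\max_{\pi'}v_{\pi'}(s)$ for all $s\in\mathcal S'$. Let $T^\pi_s$ be the length of an episode that starts in $s$ and follows $\pi$. For $q:\mathcal S'\times\mathcal A\to\mathbb R$ let $\mathrm{gap}(q)$ be the minimum, over all states $s$ at which some action does not maximize $q(s,\cdot)$, of the difference between $\max_a q(s,a)$ and the maximum of $q(s,a)$ over the actions $a$ that do not maximize $q(s,\cdot)$ (with $\mathrm{gap}(q)=\infty$ if there is no such state). Put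 $\Delta_\star=\mathrm{gap}(q_\star)$, the gap of $q_{\pi_\star}$ for every optimal policy $\pi_\star$, and $\Delta=\min_\pi\mathrm{gap}(q_\pi)$. With $\eta=1-e^{-1}$, let the real number $K>0$ be any upper bound of $$\min\Bigl\{k\in\mathbb N:\ \min_\pi\min_{s\in\mathcal S'}\mathbb P(T^\pi_s\le k)\ge\eta\Bigr\}.$$ Assume that $\Delta_\star<\infty$ and that $$L_\star=\Bigl\lceil\frac{2K}{\eta}\log\frac{K}{\eta\,\Delta_\star}\Bigr\rceil$$ is at least $1$. For $\delta\in(0,1)$ let $$N(\delta)=\left\lceil\frac{8K^2}{\Delta^2}\left(\log\frac{2SA}{1-(1-\delta)^{1/L_\star}}\right)^3\right\rceil .$$ The modified MCES algorithm with parameters $L,N$ starts from an arbitrary policy and repeats the following two steps $L$ times. Evaluation: for every $(s,a)\in\mathcal S'\times\mathcal A$ generate $N$ independent episodes that start in $s$, take action $a$ and then follow the current policy, and let $Q(s,a)$ be the average of their $N$ undiscounted returns; the episodes of different pairs $(s,a)$ are independent, and given the current policy the episodes are independent of the past. Improvement: replace the current policy by one that selects in each state $s$ an action maximizing $Q(s,\cdot)$,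 ties being broken in an arbitrary manner. The output is the policy after the last improvement step. Theorem. For every $\delta\in(0,1)$, the modified MCES algorithm with $L=L_\star$ iterations and $N=N(\delta)$ episodes per state-action pair and iteration outputs an optimal policy with probability at least $1-\delta$. -/

import Mathlib

open MeasureTheory ProbabilityTheory

noncomputable section

/-- The state space of an episodic MDP with transient states `σ`: `none` is the terminal state.
It is finite and carries the discrete σ-algebra. -/
instance instMeasurableSpaceOptionDiscrete {σ : Type*} : MeasurableSpace (Option σ) := ⊤

instance instDiscreteMeasurableSpaceOption {σ : Type*} : DiscreteMeasurableSpace (Option σ) :=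
  ⟨fun _ => trivial⟩

namespace MCES

/-- An episodic MDP with transient states `σ`, actions `A`, one absorbing terminal state `none`,
transition probabilities `p s a` and immediate rewards in `[0,1]`. The transition out of the
terminal state is not data: it is fixed in `stepKernel` below. -/
structure EpisodicMDP (σ A : Type*) where
  p : σ → A → PMF (Option σ)
  r : σ → A → ℝ
  r_nonneg : ∀ s a, 0 ≤ r s a
  r_le_one : ∀ s a, r s a ≤ 1

/-- Deterministic stationary policies. -/
abbrev Policy (σ A : Type*) := σ → A

variable {σ A : Type*}

/-- The action taken at time `t` in state `s` in an episode whose first action is `a` and that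
follows `π` thereafter. -/
def actionAt (π : Policy σ A) (a : A) (t : ℕ) (s : σ) : A :=
  if t = 0 then a else π s

section Episodes

variable [Fintype σ]

/-- The transition from the state at time `t` to the state at time `t + 1`; the terminal state
is absorbing. -/
def stepKernel (M : EpisodicMDP σ A) (π : Policy σ A) (a : A) (t : ℕ) :
    Kernel (Option σ) (Option σ) where
  toFun x := match x with
    | none => Measure.dirac none
    | some s => (M.p s (actionAt π a t s)).toMeasure
  measurable' := Measurable.of_discrete

instance instIsMarkovKernelStep (M : EpisodicMDP σ A) (π : Policy σ A) (a : A) (t : ℕ) :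
    IsMarkovKernel (stepKernel M π a t) := by
  refine ⟨fun x => ?_⟩
  cases x with
  | none => exact (inferInstance : IsProbabilityMeasure (Measure.dirac (none : Option σ)))
  | some s =>
    exact (inferInstance : IsProbabilityMeasure (M.p s (actionAt π a t s)).toMeasure)

/-- The law of the state at time `t + 1` given the states at times `0, …, t`. -/
def historyKernel (M : EpisodicMDP σ A) (π : Policy σ A) (a : A) (t : ℕ) :
    Kernel ((i : Finset.Iic t) → (fun _ : ℕ => Option σ) i) (Option σ) :=
  (stepKernel M π a t).comap (fun h => h ⟨t, Finset.mem_Iic.2 le_rfl⟩) (measurable_pi_apply _)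

instance instIsMarkovKernelHistory (M : EpisodicMDP σ A) (π : Policy σ A) (a : A) (t : ℕ) :
    IsMarkovKernel (historyKernel M π a t) := by
  unfold historyKernel; infer_instance

/-- The law of the state sequence of an episode that starts in state `s`, takes action `a` and
follows `π` thereafter. -/
def episodeLaw (M : EpisodicMDP σ A) (π : Policy σ A) (s : σ) (a : A) :
    Measure (ℕ → Option σ) :=
  Kernel.traj (X := fun _ : ℕ => Option σ) (historyKernel M π a) 0 (fun _ => some s)

instance instIsProbabilityMeasureEpisode (M : EpisodicMDP σ A) (π : Policy σ A) (s : σ) (a : A) :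
    IsProbabilityMeasure (episodeLaw M π s a) := by
  unfold episodeLaw; infer_instance

end Episodes

/-- The length of an episode: the first time at which it is in the terminal state, `⊤` if it
never is. -/
def episodeLength (x : ℕ → Option σ) : ℕ∞ :=
  ⨅ (t : ℕ) (_ : x t = none), (t : ℕ∞)

/-- The reward collected at time `t`. -/
def rewardAt (M : EpisodicMDP σ A) (π : Policy σ A) (a : A) (x : ℕ → Option σ) (t : ℕ) : ℝ :=
  match x t with
  | none => 0
  | some s => M.r s (actionAt π a t s)

/-- The undiscounted return of an episode with first action `a` that follows `π` thereafter. -/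
def episodeReturn (M : EpisodicMDP σ A) (π : Policy σ A) (a : A) (x : ℕ → Option σ) : ℝ :=
  ∑ t ∈ Finset.range (episodeLength x).toNat, rewardAt M π a x t

/-- `a` maximizes `q s ·`. -/
def IsMaxAction (q : σ → A → ℝ) (s : σ) (a : A) : Prop := ∀ b, q s b ≤ q s a

/-- The difference between the best and the second-best value of `q s ·`. It is used only at
states at which some action is not maximizing. -/
def stateGap (q : σ → A → ℝ) (s : σ) : ℝ :=
  (⨆ a, q s a) - ⨆ a : {a : A // ¬ IsMaxAction q s a}, q s a

/-- The smallest gap over all states at which some action is not maximizing, and `⊤` if there is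
no such state. -/
def gap (q : σ → A → ℝ) : EReal :=
  ⨅ (s : σ) (_ : ∃ a, ¬ IsMaxAction q s a), (stateGap q s : EReal)

section Values

variable [Fintype σ]

/-- A policy is proper if from every state the terminal state is reached almost surely. -/
def IsProper (M : EpisodicMDP σ A) (π : Policy σ A) : Prop :=
  ∀ s, episodeLaw M π s (π s) {x | episodeLength x < ⊤} = 1

/-- The action-value function `q_π`. -/
def qValue (M : EpisodicMDP σ A) (π : Policy σ A) (s : σ) (a : A) : ℝ :=
  ∫ x, episodeReturn M π a x ∂(episodeLaw M π s a)

/-- The value function `v_π`. An episode that follows `π` from the start is one whose first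
action is `π s`. -/
def vValue (M : EpisodicMDP σ A) (π : Policy σ A) (s : σ) : ℝ :=
  ∫ x, episodeReturn M π (π s) x ∂(episodeLaw M π s (π s))

/-- `π` is optimal: it attains `max_π' v_π'(s)` at every state `s`. -/
def IsOptimal (M : EpisodicMDP σ A) (π : Policy σ A) : Prop :=
  ∀ (s : σ) (π' : Policy σ A), vValue M π' s ≤ vValue M π s

/-- The optimal action-value function `q_⋆(s,a) = max_π q_π(s,a)`. -/
def qStar (M : EpisodicMDP σ A) (s : σ) (a : A) : ℝ :=
  ⨆ π : Policy σ A, qValue M π s a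

/-- `Δ_⋆`, the suboptimality gap of `q_⋆`, the common action-value function of the optimal
policies. -/
def gapStar (M : EpisodicMDP σ A) : EReal := gap (qStar M)

/-- `Δ`, the smallest suboptimality gap among all policies. -/
def gapMin (M : EpisodicMDP σ A) : EReal := ⨅ π : Policy σ A, gap (qValue M π)

/-- The least `k` such that under every policy and from every state an episode ends within `k`
steps with probability at least `η`. -/
def kBar (M : EpisodicMDP σ A) (η : ℝ) : ℕ :=
  sInf {k : ℕ | ∀ (π : Policy σ A) (s : σ),
    ENNReal.ofReal η ≤ episodeLaw M π s (π s) {x | episodeLength x ≤ (k : ℕ∞)}}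

/-- The number of iterations `L(η)`, where `K` stands for `K_η`. -/
def numIter (M : EpisodicMDP σ A) (η K : ℝ) : ℕ :=
  ⌈2 * K / η * Real.log (K / (η * (gapStar M).toReal))⌉₊

/-- `L_⋆ = L(1 - e⁻¹)`, where `K` stands for `K_η` at `η = 1 - e⁻¹`. -/
def lStar (M : EpisodicMDP σ A) (K : ℝ) : ℕ := numIter M (1 - Real.exp (-1)) K

/-- The number of episodes `N(δ)` per state-action pair and iteration. -/
def numEpisodes [Fintype A] (M : EpisodicMDP σ A) (K δ : ℝ) : ℕ :=
  ⌈8 * K ^ 2 / (gapMin M).toReal ^ 2 *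
    Real.log (2 * (Fintype.card σ : ℝ) * (Fintype.card A : ℝ) /
      (1 - (1 - δ) ^ (1 / (lStar M K : ℝ)))) ^ 3⌉₊

end Values

/-- The state sequences of `N` episodes for every state-action pair. -/
abbrev Batch (σ A : Type*) (N : ℕ) := σ → A → Fin N → ℕ → Option σ

/-- The law of the `N` episodes for every state-action pair that are generated, all of them
independently, under the policy `π`. -/
def batchLaw [Fintype σ] [Fintype A] (M : EpisodicMDP σ A) (N : ℕ) (π : Policy σ A) :
    Measure (Batch σ A N) :=
  Measure.pi fun s => Measure.pi fun a => Measure.pi fun _ : Fin N => episodeLaw M π s a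

/-- The sample means of the returns of a batch of episodes generated under `π`. -/
def qEstimate (M : EpisodicMDP σ A) {N : ℕ} (π : Policy σ A) (b : Batch σ A N)
    (s : σ) (a : A) : ℝ :=
  (1 / (N : ℝ)) * ∑ i : Fin N, episodeReturn M π a (b s a i)

/-- A run of the modified MCES algorithm with `L` iterations and `N` episodes per state-action
pair and iteration. `pol t` is the policy at the start of iteration `t`, so that `pol 0` is the
arbitrary initial policy and `pol L` is the output; `ep t` holds the episodes generated in
iteration `t`; `ℱ t` is the information available at the start of iteration `t`. Ties in the
improvement step may be broken in any way, also at random or depending on the past. -/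
structure IsRun [Fintype σ] [Fintype A] (M : EpisodicMDP σ A) (L N : ℕ)
    {Ω : Type*} [mΩ : MeasurableSpace Ω] (P : Measure Ω) (ℱ : Filtration ℕ mΩ)
    (pol : ℕ → Ω → Policy σ A) (ep : ℕ → Ω → Batch σ A N) : Prop where
  /-- The policy `pol t` is determined by the information available at the start of
  iteration `t`. -/
  pol_measurable : ∀ t ≤ L, ∀ π, MeasurableSet[ℱ t] {ω | pol t ω = π}
  /-- The episodes of iteration `t` are known at its end. -/
  ep_measurable : ∀ t < L, Measurable[ℱ (t + 1)] (ep t)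
  /-- Evaluation step: given the past, the episodes of iteration `t` are independent episodes
  of the MDP under the current policy. -/
  ep_law : ∀ t < L, ∀ (π : Policy σ A) (H : Set Ω), MeasurableSet[ℱ t] H →
    ∀ B : Set (Batch σ A N), MeasurableSet B →
      P ((H ∩ {ω | pol t ω = π}) ∩ ep t ⁻¹' B)
        = P (H ∩ {ω | pol t ω = π}) * batchLaw M N π B
  /-- Improvement step: the next policy is greedy with respect to the estimate. -/
  greedy : ∀ t < L, ∀ ω s,
    IsMaxAction (qEstimate M (pol t ω) (ep t ω)) s (pol (t + 1) ω s)

end MCES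

end

/-!
A run outputs an optimal policy because, with the required probability, every one of its
improvement steps coincides with a step of exact policy iteration, and `L_⋆` steps of exact policy
iteration reach an optimal policy from any start.

*Exact policy iteration.* Let `P` be the substochastic transition matrix of an optimal policy on the
transient states and `h` its expected episode length. A block of `k = kBar` steps is survived with
probability at most `e⁻¹`, so `h ≤ k / (1 - e⁻¹) ≤ H` with `H = K / η`. Since `P h = h - 1`, the
bound `v_⋆ - v ≤ c h`, which holds at the start with `c = 1`, improves in each greedy step by the
factor `1 - 1 / H` (`policyIteration_contraction`). Once `(1 - 1 / H) ^ L * H` is below the gap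
`Δ_⋆`, the last greedy step can select only actions that are optimal for `q_⋆`
(`policyIteration_isOptimal`). The same matrices give the Bellman equation (`qValue_eq`), and the
comparison principle `nonpos_of_le_mulVec` gives policy improvement and the existence of an optimal
policy. Only the marginal laws of the states and the absorption of the terminal state are used of
the episode law.

*Evaluation.* A greedy choice for `Q` is greedy for `q_π` when all errors are below `Δ / 2`
(`isMaxAction_of_accurate`). Apart from the first reward, which is a constant, a return is a
nonnegative variable `Z` with `P(Z > m k) ≤ e⁻ᵐ`. With `l = log (2SA / δ')`, where
`δ' = 1 - (1 - δ) ^ (1 / L)`, one has `l ≥ log 4`, and the mean of `N` copies deviates by `Δ / 2`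
with probability at most `2 e⁻ˡ = δ' / (SA)` (`sampleMean_tail_le`): by Chebyshev's inequality for
`l ≤ 4`, where it is stronger than exponential bounds, and by a Chernoff bound for `l ≥ 4`, where
the exponent is of order `l ^ 3`. A union bound over the pairs and the product over the iterations
(`IsRun.pow_le_measure`) give `(1 - δ') ^ L = 1 - δ`.
-/

open MeasureTheory ProbabilityTheory

noncomputable section

/-! ### Marginal laws along an episode -/

namespace MCES

variable {σ A : Type*}

lemma measurableSet_state_mem (t : ℕ) (B : Set (Option σ)) :
    MeasurableSet {x : ℕ → Option σ | x t ∈ B} :=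
  measurable_pi_apply (X := fun _ => Option σ) t (MeasurableSet.of_discrete (s := B))

lemma measurableSet_state_eq (t : ℕ) (y : Option σ) :
    MeasurableSet {x : ℕ → Option σ | x t = y} :=
  measurableSet_state_mem t {y}

section Paths

variable (M : EpisodicMDP σ A) (π : Policy σ A) (s : σ) (a : A)

/-- The joint law of two consecutive states of an episode. -/
lemma episodeLaw_joint (t : ℕ) (B C : Set (Option σ)) :
    episodeLaw M π s a {x | x t ∈ B ∧ x (t + 1) ∈ C} =
      ∫⁻ x in {x | x t ∈ B}, stepKernel M π a t (x t) C ∂(episodeLaw M π s a) := by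
  have hB : MeasurableSet B := MeasurableSet.of_discrete
  have hC : MeasurableSet C := MeasurableSet.of_discrete
  have hg : Measurable fun h : ((i : Finset.Iic t) → (fun _ : ℕ => Option σ) i) =>
      h ⟨t, Finset.mem_Iic.2 le_rfl⟩ := measurable_pi_apply _
  have key := Kernel.partialTraj_compProd_eq_map_traj (X := fun _ : ℕ => Option σ)
    (κ := historyKernel M π a) (Nat.zero_le t) (x₀ := fun _ => some s)
  have h1 : episodeLaw M π s a {x | x t ∈ B ∧ x (t + 1) ∈ C} =
      ((Kernel.traj (X := fun _ : ℕ => Option σ) (historyKernel M π a) 0 (fun _ => some s)).map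
        (fun x ↦ (Preorder.frestrictLe t x, x (t + 1))))
        (((fun h : ((i : Finset.Iic t) → (fun _ : ℕ => Option σ) i) =>
          h ⟨t, Finset.mem_Iic.2 le_rfl⟩) ⁻¹' B) ×ˢ C) := by
    rw [Measure.map_apply (by fun_prop) ((hg hB).prod hC)]
    rfl
  rw [h1, ← key, Measure.compProd_apply_prod (hg hB) hC,
    ← Kernel.traj_map_frestrictLe_apply, setLIntegral_map (hg hB) ?_ (by fun_prop)]
  · rfl
  · exact Kernel.measurable_coe _ hC

/-- The terminal state is absorbing along almost every episode. -/
lemma episodeLaw_absorbing :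
    ∀ᵐ x ∂(episodeLaw M π s a), ∀ t, x t = none → x (t + 1) = none := by
  rw [ae_all_iff]
  intro t
  have h := episodeLaw_joint M π s a t {none} {none}ᶜ
  have h0 : ∫⁻ x in {x : ℕ → Option σ | x t ∈ ({none} : Set (Option σ))},
      stepKernel M π a t (x t) {none}ᶜ ∂(episodeLaw M π s a) = 0 := by
    rw [setLIntegral_congr_fun (g := fun _ => 0)
      (measurableSet_state_mem t {none})]
    · simp
    · intro x hx
      have : x t = none := hx
      simp only [this]
      change Measure.dirac (none : Option σ) {none}ᶜ = 0
      rw [Measure.dirac_apply' _ MeasurableSet.of_discrete]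
      simp
  rw [h0] at h
  rw [ae_iff]
  convert h using 2
  ext x
  simp

lemma episodeLaw_start : ∀ᵐ x ∂(episodeLaw M π s a), x 0 = some s := by
  have h := Kernel.traj_map_frestrictLe_apply (X := fun _ : ℕ => Option σ)
    (κ := historyKernel M π a) 0 0 (fun _ => some s)
  rw [Kernel.partialTraj_self, Kernel.id_apply] at h
  have h2 : ∀ᵐ y ∂((Kernel.traj (X := fun _ : ℕ => Option σ) (historyKernel M π a) 0
      (fun _ => some s)).map (Preorder.frestrictLe 0)), y ⟨0, by simp⟩ = some s := by
    rw [h, ae_dirac_iff]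
    exact (measurable_pi_apply (X := fun _ => Option σ) _) (MeasurableSet.of_discrete (s := {some s}))
  exact ae_of_ae_map (by fun_prop) h2

/-- The forward equation for the law of the state at a fixed time. -/
lemma episodeLaw_marginal_succ [Fintype σ] (t : ℕ) (z : σ) :
    (episodeLaw M π s a).real {x | x (t + 1) = some z} =
      ∑ y, (episodeLaw M π s a).real {x | x t = some y} *
        (M.p y (actionAt π a t y) (some z)).toReal := by
  have hdec : (episodeLaw M π s a).real {x | x (t + 1) = some z} =
      ∑ y : Option σ, (episodeLaw M π s a).real {x | x t ∈ ({y} : Set (Option σ)) ∧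
        x (t + 1) ∈ ({some z} : Set (Option σ))} := by
    rw [← measureReal_biUnion_finset]
    · congr 1
      ext x
      simp
    · intro y _ y' _ hyy
      refine Set.disjoint_left.2 fun x hx hx' => hyy ?_
      exact hx.1.symm.trans hx'.1
    · intro y _
      exact (measurableSet_state_eq t y).inter (measurableSet_state_eq (t + 1) (some z))
  have hone : ∀ y : Option σ, (episodeLaw M π s a).real {x | x t ∈ ({y} : Set (Option σ)) ∧
        x (t + 1) ∈ ({some z} : Set (Option σ))} =
      (episodeLaw M π s a).real {x | x t = y} * (stepKernel M π a t y {some z}).toReal := by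
    intro y
    rw [measureReal_def, episodeLaw_joint, setLIntegral_congr_fun
      (g := fun _ => stepKernel M π a t y {some z}) (measurableSet_state_mem t {y})]
    · rw [lintegral_const, Measure.restrict_apply MeasurableSet.univ, Set.univ_inter,
        ENNReal.toReal_mul, mul_comm, measureReal_def]
      rfl
    · intro x hx
      have : x t = y := hx
      simp only [this]
  rw [hdec, Fintype.sum_option]
  simp only [hone]
  have hnone : stepKernel M π a t none {some z} = 0 := by
    change Measure.dirac (none : Option σ) {some z} = 0
    rw [Measure.dirac_apply' _ MeasurableSet.of_discrete]
    simp
  rw [hnone]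
  simp only [ENNReal.toReal_zero, mul_zero, zero_add]
  refine Finset.sum_congr rfl fun y _ => ?_
  congr 2
  change (M.p y (actionAt π a t y)).toMeasure {some z} = _
  rw [PMF.toMeasure_apply_singleton _ _ MeasurableSet.of_discrete]

lemma measurable_rewardAt [Finite σ] (t : ℕ) : Measurable fun x : ℕ → Option σ => rewardAt M π a x t :=
  (measurable_of_finite (fun y : Option σ => match y with
    | none => (0 : ℝ)
    | some s => M.r s (actionAt π a t s))).comp (measurable_pi_apply t)

lemma rewardAt_nonneg (x : ℕ → Option σ) (t : ℕ) : 0 ≤ rewardAt M π a x t := by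
  unfold rewardAt
  split
  · exact le_rfl
  · exact M.r_nonneg _ _

lemma rewardAt_le_one (x : ℕ → Option σ) (t : ℕ) : rewardAt M π a x t ≤ 1 := by
  unfold rewardAt
  split
  · exact zero_le_one
  · exact M.r_le_one _ _

lemma rewardAt_of_none {x : ℕ → Option σ} {t : ℕ} (h : x t = none) : rewardAt M π a x t = 0 := by
  simp [rewardAt, h]

lemma integrable_rewardAt [Finite σ] (t : ℕ) :
    Integrable (fun x => rewardAt M π a x t) (episodeLaw M π s a) := by
  refine Integrable.of_bound (C := 1) (measurable_rewardAt M π a t).aestronglyMeasurable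
    (.of_forall fun x => ?_)
  rw [Real.norm_of_nonneg (rewardAt_nonneg M π a x t)]
  exact rewardAt_le_one M π a x t

end Paths

/-- The transition matrix of `π` restricted to the transient states; it is substochastic. -/
def transMatrix (M : EpisodicMDP σ A) (π : Policy σ A) : Matrix σ σ ℝ :=
  fun s z => (M.p s (π s) (some z)).toReal

section Marginals

variable [Fintype σ] [DecidableEq σ] (M : EpisodicMDP σ A) (π : Policy σ A) (s : σ) (a : A)

open Matrix

lemma episodeLaw_marginal (t : ℕ) (z : σ) :
    (episodeLaw M π s a).real {x | x (t + 1) = some z} =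
      ((fun y => (M.p s a (some y)).toReal) ᵥ* transMatrix M π ^ t) z := by
  induction t generalizing z with
  | zero =>
    rw [episodeLaw_marginal_succ, pow_zero, vecMul_one]
    have h0 : ∀ y : σ, (episodeLaw M π s a).real {x | x 0 = some y} = if s = y then 1 else 0 := by
      intro y
      split_ifs with h
      · subst h
        have : (episodeLaw M π s a) {x | x 0 = some s} = 1 :=
          (prob_compl_eq_zero_iff₀ ((measurable_pi_apply (X := fun _ => Option σ) 0)
            (MeasurableSet.of_discrete (s := {some s}))).nullMeasurableSet).1
            (episodeLaw_start M π s a)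
        simp [measureReal_def, this]
      · rw [measureReal_def, measure_mono_null _ (episodeLaw_start M π s a)]
        · simp
        · intro x hx hx'
          have h1 : x 0 = some y := hx
          have h2 : x 0 = some s := hx'
          exact h (Option.some.inj (h2.symm.trans h1))
    simp [h0, actionAt]
  | succ t ih =>
    rw [episodeLaw_marginal_succ, pow_succ, ← vecMul_vecMul]
    simp only [ih]
    rfl

/-- The probability that an episode is still running at time `t + 1`. -/
lemma episodeLaw_alive (t : ℕ) :
    (episodeLaw M π s a).real {x | x (t + 1) ≠ none} =
      ∑ z, (M.p s a (some z)).toReal * (transMatrix M π ^ t *ᵥ 1) z := by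
  have h1 : (episodeLaw M π s a).real {x | x (t + 1) ≠ none} =
      ∑ z : σ, (episodeLaw M π s a).real {x | x (t + 1) = some z} := by
    rw [← measureReal_biUnion_finset]
    · congr 1
      ext x
      simp [Option.ne_none_iff_exists, eq_comm]
    · intro y _ y' _ hyy
      refine Set.disjoint_left.2 fun x hx hx' => hyy ?_
      exact Option.some.inj ((Eq.symm hx).trans hx')
    · exact fun y _ => measurableSet_state_eq _ _
  rw [h1]
  simp only [episodeLaw_marginal]
  have := dotProduct_mulVec (fun y => (M.p s a (some y)).toReal) (transMatrix M π ^ t) 1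
  rw [dotProduct_one] at this
  exact this.symm

/-- The expected reward at time `t + 1`. -/
lemma integral_rewardAt_succ (t : ℕ) :
    ∫ x, rewardAt M π a x (t + 1) ∂(episodeLaw M π s a) =
      ∑ z, (M.p s a (some z)).toReal * (transMatrix M π ^ t *ᵥ fun y => M.r y (π y)) z := by
  have h1 : ∀ x : ℕ → Option σ, rewardAt M π a x (t + 1) =
      ∑ z, {x : ℕ → Option σ | x (t + 1) = some z}.indicator (fun _ => M.r z (π z)) x := by
    intro x
    unfold rewardAt
    split
    · rename_i h
      simp [Set.indicator, h]
    · rename_i y h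
      simp [Set.indicator, h, actionAt]
  simp only [h1]
  rw [integral_finsetSum]
  · have := dotProduct_mulVec (fun y => (M.p s a (some y)).toReal) (transMatrix M π ^ t)
      (fun y => M.r y (π y))
    refine Eq.trans (Finset.sum_congr rfl fun z _ => ?_) this.symm
    rw [integral_indicator_const _ (measurableSet_state_eq _ _), smul_eq_mul, episodeLaw_marginal]
  · exact fun z _ => (integrable_const _).indicator (measurableSet_state_eq _ _)

end Marginals

end MCES

/-! ### Survival probabilities under a policy -/

namespace MCES

variable {σ A : Type*}

lemma episodeLength_le_iff (x : ℕ → Option σ) (n : ℕ) :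
    episodeLength x ≤ n ↔ ∃ t ≤ n, x t = none := by
  constructor
  · intro h
    by_contra! hc
    have h1 : ((n + 1 : ℕ) : ℕ∞) ≤ episodeLength x := by
      refine le_iInf₂ fun t ht => ?_
      have : n < t := by
        by_contra! hlt
        exact hc t hlt ht
      exact_mod_cast this
    have h2 := h1.trans h
    norm_cast at h2
    omega
  · rintro ⟨t, ht, hx⟩
    exact (iInf₂_le t hx).trans (by exact_mod_cast ht)

lemma episodeLength_lt_top_iff (x : ℕ → Option σ) :
    episodeLength x < ⊤ ↔ ∃ t, x t = none := by
  constructor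
  · intro h
    obtain ⟨n, hn⟩ := ENat.ne_top_iff_exists.1 h.ne
    obtain ⟨t, -, ht⟩ := (episodeLength_le_iff x n).1 hn.symm.le
    exact ⟨t, ht⟩
  · rintro ⟨t, ht⟩
    exact ((episodeLength_le_iff x t).2 ⟨t, le_rfl, ht⟩).trans_lt (ENat.natCast_lt_top t)

lemma eq_none_of_le {x : ℕ → Option σ} (hx : ∀ t, x t = none → x (t + 1) = none) {t n : ℕ}
    (htn : t ≤ n) (ht : x t = none) : x n = none := by
  induction n, htn using Nat.le_induction with
  | base => exact ht
  | succ n _ ih => exact hx n ih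

lemma episodeLaw_length_le (M : EpisodicMDP σ A) (π : Policy σ A) (s : σ) (a : A) (n : ℕ) :
    episodeLaw M π s a {x | episodeLength x ≤ n} = episodeLaw M π s a {x | x n = none} := by
  refine measure_congr ?_
  filter_upwards [episodeLaw_absorbing M π s a] with x hx
  refine propext ((episodeLength_le_iff x n).trans ⟨?_, fun h => ⟨n, le_rfl, h⟩⟩)
  rintro ⟨t, htn, ht⟩
  exact eq_none_of_le hx htn ht

lemma episodeLaw_running (M : EpisodicMDP σ A) (π : Policy σ A) (s : σ) (a : A) (n : ℕ) :
    (episodeLaw M π s a).real {x | x n ≠ none} =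
      1 - (episodeLaw M π s a {x | episodeLength x ≤ n}).toReal := by
  rw [episodeLaw_length_le]
  exact probReal_compl_eq_one_sub (measurableSet_state_eq n none)

lemma IsProper.tendsto_length {M : EpisodicMDP σ A} {π : Policy σ A} (h : IsProper M π) (s : σ) :
    Filter.Tendsto (fun n : ℕ => episodeLaw M π s (π s) {x | episodeLength x ≤ n}) Filter.atTop (nhds 1) := by
  have hU : {x : ℕ → Option σ | episodeLength x < ⊤} = ⋃ n : ℕ, {x | episodeLength x ≤ n} := by
    ext x
    simp only [Set.mem_ofPred_eq, Set.mem_iUnion]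
    constructor
    · intro hx
      obtain ⟨t, ht⟩ := (episodeLength_lt_top_iff x).1 hx
      exact ⟨t, (episodeLength_le_iff x t).2 ⟨t, le_rfl, ht⟩⟩
    · rintro ⟨n, hn⟩
      exact hn.trans_lt (ENat.natCast_lt_top n)
  rw [← h s, hU]
  refine tendsto_measure_iUnion_atTop fun m n hmn x hx => ?_
  exact le_trans (α := ℕ∞) hx (by exact_mod_cast hmn)

section Survival

open Matrix Filter Topology

variable [Fintype σ]

lemma transMatrix_mulVec_mono (M : EpisodicMDP σ A) (π : Policy σ A) {f g : σ → ℝ} (h : f ≤ g) :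
    transMatrix M π *ᵥ f ≤ transMatrix M π *ᵥ g := by
  intro s
  refine Finset.sum_le_sum fun z _ => mul_le_mul_of_nonneg_left (h z) ENNReal.toReal_nonneg

lemma sum_toReal_some_le_one (M : EpisodicMDP σ A) (s : σ) (a : A) : ∑ z, (M.p s a (some z)).toReal ≤ 1 := by
  have h := (M.p s a).tsum_coe
  rw [tsum_fintype, Fintype.sum_option] at h
  rw [← ENNReal.toReal_sum fun z _ => (M.p s a).apply_ne_top _]
  refine ENNReal.toReal_le_of_le_ofReal zero_le_one ?_
  rw [ENNReal.ofReal_one, ← h]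
  exact le_add_self

variable [DecidableEq σ]

/-- The probability that an episode that starts in `s` and follows `π` is still running at
time `n`. -/
def survival (M : EpisodicMDP σ A) (π : Policy σ A) (n : ℕ) : σ → ℝ :=
  transMatrix M π ^ n *ᵥ 1

variable (M : EpisodicMDP σ A) (π : Policy σ A)

lemma survival_zero : survival M π 0 = 1 := by simp [survival]

lemma survival_succ (n : ℕ) : survival M π (n + 1) = transMatrix M π *ᵥ survival M π n := by
  simp [survival, pow_succ', mulVec_mulVec]

lemma survival_eq (n : ℕ) (s : σ) :
    survival M π n s = (episodeLaw M π s (π s)).real {x | x n ≠ none} := by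
  cases n with
  | zero =>
    have h : episodeLaw M π s (π s) {x | x 0 ≠ none}ᶜ = 0 := by
      refine measure_mono_null ?_ (episodeLaw_start M π s (π s))
      intro x hx hx'
      have h1 : x 0 = some s := hx'
      simp [h1] at hx
    have h1 : episodeLaw M π s (π s) {x | x 0 ≠ none} = 1 :=
      (prob_compl_eq_zero_iff (measurableSet_state_mem 0 {none}ᶜ)).1 h
    simp [survival_zero, measureReal_def, h1]
  | succ n =>
    rw [episodeLaw_alive, survival_succ]
    rfl

lemma transMatrix_pow_mulVec_mono (n : ℕ) {f g : σ → ℝ} (h : f ≤ g) :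
    transMatrix M π ^ n *ᵥ f ≤ transMatrix M π ^ n *ᵥ g := by
  induction n with
  | zero => simpa using h
  | succ n ih =>
    rw [pow_succ', ← mulVec_mulVec, ← mulVec_mulVec]
    exact transMatrix_mulVec_mono M π ih

lemma survival_nonneg (n : ℕ) (s : σ) : 0 ≤ survival M π n s := by
  rw [survival_eq]
  exact measureReal_nonneg

lemma survival_le_one (n : ℕ) (s : σ) : survival M π n s ≤ 1 := by
  rw [survival_eq]
  exact measureReal_le_one

lemma survival_antitone : Antitone (survival M π) := by
  refine antitone_nat_of_succ_le fun n => ?_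
  have h : transMatrix M π *ᵥ 1 ≤ 1 := by
    intro s
    simpa [survival] using survival_le_one M π 1 s
  simpa [survival, pow_succ, mulVec_mulVec] using transMatrix_pow_mulVec_mono M π n h

/-- If from every state the episode ends within `k` steps with probability at least `1 - e⁻¹`,
then survival decays by a factor `e⁻¹` in every block of `k` steps. -/
lemma survival_mul_le {k : ℕ} (hk : ∀ s, survival M π k s ≤ Real.exp (-1)) (m : ℕ) (s : σ) :
    survival M π (m * k) s ≤ Real.exp (-m) := by
  induction m generalizing s with
  | zero => simp [survival_zero]
  | succ m ih =>
    have h1 : survival M π ((m + 1) * k) = transMatrix M π ^ (m * k) *ᵥ survival M π k := by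
      simp [survival, add_mul, pow_add, mulVec_mulVec]
    have h2 : survival M π k ≤ Real.exp (-1) • (1 : σ → ℝ) := fun z => by simpa using hk z
    have h3 := transMatrix_pow_mulVec_mono M π (m * k) h2 s
    rw [h1]
    refine h3.trans ?_
    rw [mulVec_smul, Pi.smul_apply, smul_eq_mul]
    refine (mul_le_mul_of_nonneg_left (ih s) (Real.exp_pos _).le).trans_eq ?_
    rw [← Real.exp_add]
    push_cast
    ring_nf

lemma survival_eq_one_sub (n : ℕ) (s : σ) :
    survival M π n s = 1 - (episodeLaw M π s (π s) {x | episodeLength x ≤ n}).toReal := by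
  rw [survival_eq, episodeLaw_running]

/-- The set of which `kBar` is the infimum is nonempty when all policies are proper, so that
`kBar` is attained. -/
lemma survival_kBar_le [Finite A] {M : EpisodicMDP σ A} (h : ∀ π : Policy σ A, IsProper M π)
    (π : Policy σ A) (s : σ) :
    survival M π (kBar M (1 - Real.exp (-1))) s ≤ Real.exp (-1) := by
  have hη : ENNReal.ofReal (1 - Real.exp (-1)) < 1 := by
    rw [ENNReal.ofReal_lt_one]
    linarith [Real.exp_pos (-1)]
  have hne : {k : ℕ | ∀ (π : Policy σ A) (s : σ), ENNReal.ofReal (1 - Real.exp (-1)) ≤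
      episodeLaw M π s (π s) {x | episodeLength x ≤ (k : ℕ∞)}}.Nonempty := by
    have hev : ∀ᶠ k : ℕ in atTop, ∀ (π : Policy σ A) (s : σ),
        ENNReal.ofReal (1 - Real.exp (-1)) ≤
          episodeLaw M π s (π s) {x | episodeLength x ≤ (k : ℕ∞)} := by
      rw [eventually_all]
      intro π
      rw [eventually_all]
      intro s
      exact ((h π).tendsto_length s).eventually_const_le hη
    exact hev.exists
  have hmem := Nat.sInf_mem hne π s
  rw [survival_eq_one_sub]
  have h2 := ENNReal.toReal_mono (measure_ne_top _ _) hmem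
  have h3 : 0 ≤ 1 - Real.exp (-1) := by
    have := Real.exp_le_one_iff.2 (show (-1 : ℝ) ≤ 0 by norm_num)
    linarith
  rw [ENNReal.toReal_ofReal h3] at h2
  have h4 : (episodeLaw M π s (π s) {x | episodeLength x ≤ (kBar M (1 - Real.exp (-1)) : ℕ)}).toReal
    ≥ 1 - Real.exp (-1) := h2
  linarith

lemma kBar_pos [Finite A] {M : EpisodicMDP σ A} (h : ∀ π : Policy σ A, IsProper M π)
    (π : Policy σ A) (s : σ) : 0 < kBar M (1 - Real.exp (-1)) := by
  rcases Nat.eq_zero_or_pos (kBar M (1 - Real.exp (-1))) with h0 | h0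
  · have := survival_kBar_le h π s
    rw [h0, survival_zero, Pi.one_apply] at this
    have h1 := Real.exp_lt_one_iff.2 (show (-1 : ℝ) < 0 by norm_num)
    linarith
  · exact h0

section Horizon

variable {M π} {k : ℕ} (hk0 : 0 < k) (hk : ∀ s, survival M π k s ≤ Real.exp (-1))
include hk0 hk

lemma sum_survival_le (n : ℕ) (s : σ) :
    ∑ i ∈ Finset.range n, survival M π i s ≤ k / (1 - Real.exp (-1)) := by
  have hblock : ∀ m : ℕ, ∑ i ∈ Finset.range (m * k), survival M π i s ≤
      k * ∑ j ∈ Finset.range m, Real.exp (-1) ^ j := by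
    intro m
    induction m with
    | zero => simp
    | succ m ih =>
      rw [add_mul, one_mul, Finset.sum_range_add, Finset.sum_range_succ, mul_add]
      refine add_le_add ih ?_
      have : ∀ i ∈ Finset.range k, survival M π (m * k + i) s ≤ Real.exp (-1) ^ m := by
        intro i _
        refine (survival_antitone M π (Nat.le_add_right _ i) s).trans ?_
        refine (survival_mul_le M π hk m s).trans_eq ?_
        rw [← Real.exp_nat_mul]
        ring_nf
      simpa using Finset.sum_le_card_nsmul _ _ _ this
  have h1 := Real.exp_lt_one_iff.2 (show (-1 : ℝ) < 0 by norm_num)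
  calc ∑ i ∈ Finset.range n, survival M π i s
      ≤ ∑ i ∈ Finset.range (n * k), survival M π i s :=
        Finset.sum_le_sum_of_subset_of_nonneg
          (Finset.range_subset_range.2 (Nat.le_mul_of_pos_right n hk0))
          fun i _ _ => survival_nonneg M π i s
    _ ≤ k * ∑ j ∈ Finset.range n, Real.exp (-1) ^ j := hblock n
    _ ≤ k * (1 - Real.exp (-1))⁻¹ := by
        gcongr
        rw [← tsum_geometric_of_lt_one (Real.exp_pos _).le h1]
        exact (summable_geometric_of_lt_one (Real.exp_pos _).le h1).sum_le_tsum _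
          fun i _ => (pow_pos (Real.exp_pos _) i).le
    _ = k / (1 - Real.exp (-1)) := rfl

lemma summable_survival (s : σ) : Summable fun n => survival M π n s :=
  summable_of_sum_range_le (fun n => survival_nonneg M π n s)
    fun n => sum_survival_le hk0 hk n s

/-- The expected length `h s` of an episode that starts in `s` and follows `π`, as the sum of the
survival probabilities. -/
lemma exists_expectedLength : ∃ h : σ → ℝ, (∀ s, 0 ≤ h s) ∧
    (∀ s, h s ≤ k / (1 - Real.exp (-1))) ∧ h = 1 + transMatrix M π *ᵥ h := by
  refine ⟨fun s => ∑' n, survival M π n s, fun s => tsum_nonneg fun n => survival_nonneg M π n s,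
    fun s => Real.tsum_le_of_sum_range_le (fun n => survival_nonneg M π n s)
      fun n => sum_survival_le hk0 hk n s, ?_⟩
  ext s
  rw [(summable_survival hk0 hk s).tsum_eq_zero_add, survival_zero]
  simp only [Pi.add_apply, Pi.one_apply, survival_succ]
  congr 1
  simp only [mulVec, dotProduct]
  rw [Summable.tsum_finsetSum fun z _ => (summable_survival hk0 hk z).mul_left _]
  simp only [tsum_mul_left]

end Horizon

end Survival

end MCES

/-! ### Returns and the Bellman equation -/

namespace MCES

variable {σ A : Type*}

lemma measurable_episodeLength_toNat :
    Measurable fun x : ℕ → Option σ => (episodeLength x).toNat := by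
  classical
  have : BorelSpace ℕ∞ := ⟨borel_eq_top_of_countable.symm⟩
  have h : Measurable fun x : ℕ → Option σ => episodeLength x := by
    have he : ∀ x : ℕ → Option σ, episodeLength x = ⨅ t : ℕ, if x t = none then (t : ℕ∞) else ⊤ :=
      fun x => iInf_congr fun t => by split_ifs with h <;> simp [h]
    simp only [he]
    exact Measurable.iInf fun t =>
      Measurable.ite (measurableSet_state_eq t none) measurable_const measurable_const
  exact (measurable_of_countable ENat.toNat).comp h

lemma measurable_episodeReturn [Finite σ] (M : EpisodicMDP σ A) (π : Policy σ A) (a : A) :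
    Measurable (episodeReturn M π a) := by
  have h : Measurable fun p : ℕ × (ℕ → Option σ) =>
      ∑ t ∈ Finset.range p.1, rewardAt M π a p.2 t :=
    measurable_from_prod_countable_right fun n =>
      Finset.measurable_fun_sum (Finset.range n) fun t _ => measurable_rewardAt M π a t
  exact h.comp (measurable_episodeLength_toNat.prodMk measurable_id)

/-- The return net of the first reward of an episode that starts in a transient state is bounded
by the number of remaining steps. -/
lemma episodeReturn_sub_le (M : EpisodicMDP σ A) (π : Policy σ A) (s : σ) (a : A)
    {x : ℕ → Option σ} (h0 : x 0 = some s) {n : ℕ} (hn : x (n + 1) = none) :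
    episodeReturn M π a x - M.r s a ≤ n := by
  have hT : (episodeLength x).toNat ≤ n + 1 :=
    ENat.toNat_le_of_le_natCast ((episodeLength_le_iff x (n + 1)).2 ⟨n + 1, le_rfl, hn⟩)
  have hr : rewardAt M π a x 0 = M.r s a := by simp [rewardAt, h0, actionAt]
  have h1 : episodeReturn M π a x ≤ ∑ t ∈ Finset.range (n + 1), rewardAt M π a x t :=
    Finset.sum_le_sum_of_subset_of_nonneg (Finset.range_subset_range.2 hT)
      fun t _ _ => rewardAt_nonneg M π a x t
  rw [Finset.sum_range_succ', hr] at h1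
  have h2 : ∑ t ∈ Finset.range n, rewardAt M π a x (t + 1) ≤ n := by
    simpa using Finset.sum_le_card_nsmul (Finset.range n) _ 1
      fun t _ => rewardAt_le_one M π a x (t + 1)
  linarith

lemma episodeReturn_sub_nonneg (M : EpisodicMDP σ A) (π : Policy σ A) (s : σ) (a : A)
    {x : ℕ → Option σ} (h0 : x 0 = some s) {n : ℕ} (hn : x n = none) :
    0 ≤ episodeReturn M π a x - M.r s a := by
  have hr : rewardAt M π a x 0 = M.r s a := by simp [rewardAt, h0, actionAt]
  have hT : 0 < (episodeLength x).toNat := by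
    rw [Nat.pos_iff_ne_zero, Ne, ENat.toNat_eq_zero, not_or]
    refine ⟨fun h => ?_, ((episodeLength_lt_top_iff x).2 ⟨n, hn⟩).ne⟩
    obtain ⟨t, ht, hx⟩ := (episodeLength_le_iff x 0).1 (by simp [h])
    obtain rfl : t = 0 := by omega
    simp [h0] at hx
  rw [← hr, sub_nonneg]
  exact Finset.single_le_sum (f := fun t => rewardAt M π a x t)
    (fun t _ => rewardAt_nonneg M π a x t) (Finset.mem_range.2 hT)

lemma hasSum_rewardAt (M : EpisodicMDP σ A) (π : Policy σ A) (a : A) {x : ℕ → Option σ}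
    (habs : ∀ t, x t = none → x (t + 1) = none) {n : ℕ} (hn : x n = none) :
    HasSum (rewardAt M π a x) (episodeReturn M π a x) := by
  refine hasSum_sum_of_ne_finset_zero fun t ht => rewardAt_of_none M π a ?_
  rw [Finset.mem_range, not_lt] at ht
  have hT := (ENat.natCast_toNat ((episodeLength_lt_top_iff x).2 ⟨n, hn⟩).ne)
  obtain ⟨u, hu, hx⟩ := (episodeLength_le_iff x t).1 (hT ▸ by exact_mod_cast ht)
  exact eq_none_of_le habs hu hx

section Returns

open Matrix Filter Topology

variable [Fintype σ] [DecidableEq σ] {M : EpisodicMDP σ A} {π : Policy σ A}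
variable {k : ℕ} (hk0 : 0 < k) (hk : ∀ s, survival M π k s ≤ Real.exp (-1))
include hk

lemma episodeLaw_alive_le (s : σ) (a : A) (m : ℕ) :
    (episodeLaw M π s a).real {x | x (m * k + 1) ≠ none} ≤ Real.exp (-m) := by
  rw [episodeLaw_alive]
  calc ∑ z, (M.p s a (some z)).toReal * survival M π (m * k) z
      ≤ ∑ z, (M.p s a (some z)).toReal * Real.exp (-m) := by
        gcongr with z
        exact survival_mul_le M π hk m z
    _ ≤ 1 * Real.exp (-m) := by
        rw [← Finset.sum_mul]
        gcongr
        exact sum_toReal_some_le_one M s a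
    _ = Real.exp (-m) := one_mul _

lemma episodeLaw_terminates (s : σ) (a : A) :
    ∀ᵐ x ∂(episodeLaw M π s a), ∃ n, x n = none := by
  rw [ae_iff, ← measureReal_eq_zero_iff]
  refine le_antisymm (ge_of_tendsto' (x := atTop) (f := fun m : ℕ => Real.exp (-m)) ?_
    fun m => ?_) measureReal_nonneg
  · exact Real.tendsto_exp_neg_atTop_nhds_zero.comp tendsto_natCast_atTop_atTop
  · refine (measureReal_mono ?_).trans (episodeLaw_alive_le hk s a m)
    intro x hx hx'
    exact hx ⟨_, hx'⟩

lemma episodeReturn_sub_ae_nonneg (s : σ) (a : A) :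
    ∀ᵐ x ∂(episodeLaw M π s a), 0 ≤ episodeReturn M π a x - M.r s a := by
  filter_upwards [episodeLaw_start M π s a, episodeLaw_terminates hk s a] with x h0 ⟨n, hn⟩
  exact episodeReturn_sub_nonneg M π s a h0 hn

/-- The return net of the first reward has exponential tails with scale exactly `k`. The first
reward is a constant, so dropping it does not change deviations from the mean, and what is left is
the return of an episode that follows `π` from its random start. -/
lemma episodeReturn_tail (s : σ) (a : A) (m : ℕ) :
    episodeLaw M π s a {x | (m * k : ℝ) < episodeReturn M π a x - M.r s a} ≤
      ENNReal.ofReal (Real.exp (-m)) := by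
  rw [← ofReal_measureReal]
  refine ENNReal.ofReal_le_ofReal (le_trans ?_ (episodeLaw_alive_le hk s a m))
  refine ENNReal.toReal_mono (measure_ne_top _ _) (measure_mono_ae ?_)
  filter_upwards [episodeLaw_start M π s a] with x h0 hx hx'
  have h1 : (m * k : ℝ) < episodeReturn M π a x - M.r s a := hx
  have h2 := episodeReturn_sub_le M π s a h0 hx'
  push_cast at h2
  linarith

include hk0

/-- The Bellman equation for the action values of a policy, from the expected rewards at the
individual times. -/
lemma qValue_eq (s : σ) (a : A) :
    qValue M π s a = M.r s a + ∑ z, (M.p s a (some z)).toReal * vValue M π z := by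
  set W : ℕ → σ → ℝ := fun t => transMatrix M π ^ t *ᵥ fun y => M.r y (π y) with hW
  have hWle : ∀ t z, W t z ≤ survival M π t z := fun t =>
    transMatrix_pow_mulVec_mono M π t fun y => M.r_le_one y (π y)
  have hW0 : ∀ t z, 0 ≤ W t z := by
    intro t z
    have := transMatrix_pow_mulVec_mono M π t (f := 0) (g := fun y => M.r y (π y))
      fun y => M.r_nonneg y (π y)
    simpa using this z
  have hWs : ∀ z, Summable fun t => W t z := fun z =>
    Summable.of_nonneg_of_le (fun t => hW0 t z) (fun t => hWle t z) (summable_survival hk0 hk z)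
  have hq : ∀ s a, qValue M π s a =
      M.r s a + ∑ z, (M.p s a (some z)).toReal * ∑' t, W t z := by
    intro s a
    have hint : ∀ t, ∫ x, rewardAt M π a x (t + 1) ∂(episodeLaw M π s a) =
        ∑ z, (M.p s a (some z)).toReal * W t z := integral_rewardAt_succ M π s a
    have hsum : HasSum (fun t => ∑ z, (M.p s a (some z)).toReal * W t z)
        (∑ z, (M.p s a (some z)).toReal * ∑' t, W t z) :=
      hasSum_sum fun z _ => (hWs z).hasSum.mul_left _
    have hnorm : Summable fun t => ∫ x, ‖rewardAt M π a x t‖ ∂(episodeLaw M π s a) := by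
      rw [← summable_nat_add_iff 1]
      refine hsum.summable.congr fun t => ?_
      rw [← hint]
      exact integral_congr_ae (.of_forall fun x =>
        (Real.norm_of_nonneg (rewardAt_nonneg M π a x (t + 1))).symm)
    have hG := hasSum_integral_of_summable_integral_norm
      (fun t => integrable_rewardAt M π s a t) hnorm
    have hGq : ∫ x, ∑' t, rewardAt M π a x t ∂(episodeLaw M π s a) = qValue M π s a := by
      refine integral_congr_ae ?_
      filter_upwards [episodeLaw_absorbing M π s a, episodeLaw_terminates hk s a] with x hx ⟨n, hn⟩
      exact (hasSum_rewardAt M π a hx hn).tsum_eq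
    have h0 : ∫ x, rewardAt M π a x 0 ∂(episodeLaw M π s a) = M.r s a := by
      rw [integral_congr_ae (g := fun _ => M.r s a)]
      · simp
      · filter_upwards [episodeLaw_start M π s a] with x hx
        simp [rewardAt, hx, actionAt]
    rw [← hGq, ← hG.tsum_eq, hG.summable.tsum_eq_zero_add, h0]
    simp only [hint]
    rw [hsum.tsum_eq]
  have hv : ∀ z, vValue M π z = ∑' t, W t z := by
    intro z
    rw [(hWs z).tsum_eq_zero_add]
    have h1 : vValue M π z = qValue M π z (π z) := rfl
    have h2 : W 0 z = M.r z (π z) := by simp [hW]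
    have h3 : ∀ t, W (t + 1) z = ∑ y, (M.p z (π z) (some y)).toReal * W t y := by
      intro t
      simp only [hW, pow_succ', ← mulVec_mulVec]
      rfl
    simp only [h1, hq, h2, h3]
    rw [Summable.tsum_finsetSum fun y _ => (hWs y).mul_left _]
    simp only [tsum_mul_left]
  rw [hq]
  simp only [hv]

end Returns

end MCES

/-! ### Gaps, optimal policies and exact policy iteration -/

namespace MCES

variable {σ A : Type*}

section Gap

lemma exists_isMaxAction [Finite A] [Nonempty A] (q : σ → A → ℝ) (s : σ) :
    ∃ a, IsMaxAction q s a := Finite.exists_max (q s)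

lemma gap_le [Finite A] {q : σ → A → ℝ} {s : σ} {a b : A} (ha : IsMaxAction q s a)
    (hb : ¬ IsMaxAction q s b) : gap q ≤ ((q s a - q s b : ℝ) : EReal) := by
  refine (iInf₂_le s ⟨b, hb⟩).trans (EReal.coe_le_coe_iff.2 ?_)
  have : Nonempty A := ⟨a⟩
  have h1 : (⨆ a, q s a) ≤ q s a := ciSup_le ha
  have h2 : q s b ≤ ⨆ a : {a : A // ¬ IsMaxAction q s a}, q s a :=
    le_ciSup (f := fun a : {a : A // ¬ IsMaxAction q s a} => q s a) (Set.finite_range _).bddAbove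
      ⟨b, hb⟩
  unfold stateGap
  linarith

lemma gap_pos [Finite σ] [Finite A] (q : σ → A → ℝ) : 0 < gap q := by
  have hs : ∀ s, 0 < ⨅ (_ : ∃ a, ¬ IsMaxAction q s a), (stateGap q s : EReal) := by
    intro s
    by_cases h : ∃ a, ¬ IsMaxAction q s a
    · rw [iInf_pos h, EReal.coe_pos]
      obtain ⟨b, hb⟩ := h
      have : Nonempty {a : A // ¬ IsMaxAction q s a} := ⟨⟨b, hb⟩⟩
      obtain ⟨⟨c, hc⟩, hcs⟩ := exists_eq_ciSup_of_finite
        (f := fun a : {a : A // ¬ IsMaxAction q s a} => q s a)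
      unfold stateGap
      rw [← hcs, sub_pos]
      unfold IsMaxAction at hc
      push Not at hc
      obtain ⟨d, hd⟩ := hc
      exact hd.trans_le (le_ciSup (Set.finite_range _).bddAbove d)
    · rw [iInf_neg h]
      exact EReal.zero_lt_top
  unfold gap
  cases isEmpty_or_nonempty σ
  · rw [iInf_of_empty]
    exact EReal.zero_lt_top
  · obtain ⟨s, h⟩ := exists_eq_ciInf_of_finite
      (f := fun s => ⨅ (_ : ∃ a, ¬ IsMaxAction q s a), (stateGap q s : EReal))
    rw [← h]
    exact hs s

lemma gapMin_pos [Fintype σ] [Finite A] (M : EpisodicMDP σ A) : 0 < gapMin M := by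
  unfold gapMin
  cases isEmpty_or_nonempty (Policy σ A)
  · rw [iInf_of_empty]
    exact EReal.zero_lt_top
  · obtain ⟨π, h⟩ := exists_eq_ciInf_of_finite (f := fun π : Policy σ A => gap (qValue M π))
    rw [← h]
    exact gap_pos _

end Gap

/-- One exact policy iteration step: `π'` is greedy for the action values of `π`. -/
def IsGreedy (M : EpisodicMDP σ A) (π π' : Policy σ A) : Prop :=
  ∀ s, IsMaxAction (qValue M π) s (π' s)

lemma vValue_nonneg (M : EpisodicMDP σ A) (π : Policy σ A) (s : σ) : 0 ≤ vValue M π s :=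
  integral_nonneg fun x => Finset.sum_nonneg fun t _ => rewardAt_nonneg M π (π s) x t

section PolicyIteration

open Matrix Filter Topology

variable [Fintype σ] [DecidableEq σ] {M : EpisodicMDP σ A} {k : ℕ}

/-- Comparison principle: a subharmonic function of a proper policy is nonpositive, because the
episode dies out. -/
lemma nonpos_of_le_mulVec {π : Policy σ A} (hk : ∀ s, survival M π k s ≤ Real.exp (-1))
    {f : σ → ℝ} (hf : f ≤ transMatrix M π *ᵥ f) : f ≤ 0 := by
  have hn : ∀ n, f ≤ transMatrix M π ^ n *ᵥ f := by
    intro n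
    induction n with
    | zero => simp
    | succ n ih =>
      rw [pow_succ, ← mulVec_mulVec]
      exact ih.trans (transMatrix_pow_mulVec_mono M π n hf)
  obtain ⟨B, hB0, hB⟩ : ∃ B : ℝ, 0 ≤ B ∧ f ≤ B • (1 : σ → ℝ) := by
    refine ⟨∑ s, |f s|, Finset.sum_nonneg fun s _ => abs_nonneg _, fun s => ?_⟩
    simpa using (le_abs_self (f s)).trans
      (Finset.single_le_sum (f := fun s => |f s|) (fun s _ => abs_nonneg _) (Finset.mem_univ s))
  intro s
  have hlim : Tendsto (fun m : ℕ => B * Real.exp (-m)) atTop (𝓝 0) := by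
    simpa using (Real.tendsto_exp_neg_atTop_nhds_zero.comp
      tendsto_natCast_atTop_atTop).const_mul B
  refine ge_of_tendsto' hlim fun m => (hn (m * k) s).trans ?_
  refine (transMatrix_pow_mulVec_mono M π (m * k) hB s).trans ?_
  rw [mulVec_smul, Pi.smul_apply, smul_eq_mul]
  exact mul_le_mul_of_nonneg_left (survival_mul_le M π hk m s) hB0

variable (hk0 : 0 < k) (hk : ∀ (π : Policy σ A) (s : σ), survival M π k s ≤ Real.exp (-1))
include hk0 hk

lemma qValue_mono {π π' : Policy σ A} (h : ∀ s, vValue M π s ≤ vValue M π' s) (s : σ) (a : A) :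
    qValue M π s a ≤ qValue M π' s a := by
  rw [qValue_eq hk0 (hk π), qValue_eq hk0 (hk π')]
  gcongr with z
  exact h z

/-- The difference of the action values of two policies at an action chosen by `π''` is
propagated by the transition matrix of `π''`. -/
lemma qValue_sub (π π' π'' : Policy σ A) (s : σ) :
    qValue M π s (π'' s) - qValue M π' s (π'' s) =
      (transMatrix M π'' *ᵥ fun z => vValue M π z - vValue M π' z) s := by
  rw [qValue_eq hk0 (hk π), qValue_eq hk0 (hk π'), add_sub_add_left_eq_sub,
    ← Finset.sum_sub_distrib]
  simp only [← mul_sub]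
  rfl

/-- Policy improvement. -/
lemma vValue_le_of_improvement {π π' : Policy σ A}
    (h : ∀ s, qValue M π s (π s) ≤ qValue M π s (π' s)) (s : σ) :
    vValue M π s ≤ vValue M π' s := by
  have := nonpos_of_le_mulVec (hk π') (f := fun z => vValue M π z - vValue M π' z) ?_ s
  · simpa using this
  · intro z
    rw [← qValue_sub hk0 hk]
    exact sub_le_sub_right (h z) _

lemma isOptimal_of_isGreedy_self {π : Policy σ A} (h : IsGreedy M π π) : IsOptimal M π := by
  intro s π'
  have := nonpos_of_le_mulVec (hk π') (f := fun z => vValue M π' z - vValue M π z) ?_ s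
  · simpa using this
  · intro z
    rw [← qValue_sub hk0 hk]
    exact sub_le_sub_left (h z (π' z)) _

lemma IsOptimal.isGreedy_self [Finite A] {π : Policy σ A} (h : IsOptimal M π) :
    IsGreedy M π π := by
  intro s b
  have : Nonempty A := ⟨b⟩
  choose π' hπ' using exists_isMaxAction (qValue M π)
  have hle := vValue_le_of_improvement hk0 hk fun s => hπ' s (π s)
  calc qValue M π s b ≤ qValue M π s (π' s) := hπ' s b
    _ ≤ qValue M π' s (π' s) := qValue_mono hk0 hk hle s _
    _ ≤ qValue M π s (π s) := h s π'

/-- An optimal policy exists: a policy with the largest total value cannot be improved. -/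
lemma exists_isOptimal [Finite A] [Nonempty A] : ∃ π : Policy σ A, IsOptimal M π := by
  obtain ⟨π, hπ⟩ := Finite.exists_max fun π : Policy σ A => ∑ s, vValue M π s
  refine ⟨π, isOptimal_of_isGreedy_self hk0 hk fun s b => ?_⟩
  choose π' hπ' using exists_isMaxAction (qValue M π)
  have hle := vValue_le_of_improvement hk0 hk fun s => hπ' s (π s)
  have heq : vValue M π s = vValue M π' s :=
    (Finset.sum_eq_sum_iff_of_le fun s _ => hle s).1
      (le_antisymm (Finset.sum_le_sum fun s _ => hle s) (hπ π')) s (Finset.mem_univ s)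
  calc qValue M π s b ≤ qValue M π s (π' s) := hπ' s b
    _ ≤ qValue M π' s (π' s) := qValue_mono hk0 hk hle s _
    _ = qValue M π s (π s) := heq.symm

lemma IsOptimal.qStar_eq [Finite A] {π : Policy σ A} (h : IsOptimal M π) :
    qStar M = qValue M π := by
  ext s a
  have : Nonempty (Policy σ A) := ⟨π⟩
  refine le_antisymm (ciSup_le fun π' => qValue_mono hk0 hk (fun s => h s π') s a) ?_
  exact le_ciSup (f := fun π : Policy σ A => qValue M π s a) (Set.finite_range _).bddAbove π

lemma gapMin_le_gapStar [Finite A] [Nonempty A] : gapMin M ≤ gapStar M := by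
  obtain ⟨π, hπ⟩ := exists_isOptimal hk0 hk
  unfold gapStar
  rw [hπ.qStar_eq hk0 hk]
  exact iInf_le _ π

/-- Exact policy iteration contracts the suboptimality, measured against the expected episode
length `h` under the comparison policy, by the factor `1 - 1/H` for every bound `H` of `h`. -/
lemma policyIteration_contraction {πs : Policy σ A}
    {h : σ → ℝ} {H : ℝ} (hH : ∀ s, h s ≤ H) (hH1 : 1 ≤ H)
    (hh : h = 1 + transMatrix M πs *ᵥ h) {p : ℕ → Policy σ A} {L : ℕ}
    (hp : ∀ t < L, IsGreedy M (p t) (p (t + 1))) :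
    ∀ t ≤ L, ∀ s, vValue M πs s - vValue M (p t) s ≤ (1 - 1 / H) ^ t * h s := by
  have hH0 : 0 < H := by linarith
  have hc : 0 ≤ 1 - 1 / H := by
    rw [sub_nonneg, div_le_one hH0]
    exact hH1
  intro t
  induction t with
  | zero =>
    intro _ s
    have h1 : vValue M πs s ≤ h s := by
      have := nonpos_of_le_mulVec (hk πs) (f := fun z => vValue M πs z - h z) ?_ s
      · simpa using this
      · intro z
        have h2 : vValue M πs z = M.r z (πs z) + (transMatrix M πs *ᵥ vValue M πs) z :=
          qValue_eq hk0 (hk πs) z (πs z)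
        have h3 : h z = 1 + (transMatrix M πs *ᵥ h) z := congrFun hh z
        have h4 : (transMatrix M πs *ᵥ fun z => vValue M πs z - h z) z =
            (transMatrix M πs *ᵥ vValue M πs) z - (transMatrix M πs *ᵥ h) z :=
          congrFun (mulVec_sub (transMatrix M πs) (vValue M πs) h) z
        have h5 := M.r_le_one z (πs z)
        simp only [h4]
        linarith
    have h2 := vValue_nonneg M (p 0) s
    rw [pow_zero, one_mul]
    linarith
  | succ t ih =>
    intro ht s
    have hg := hp t ht
    have himp := vValue_le_of_improvement hk0 hk fun s => hg s (p t s)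
    have h1 : qValue M (p t) s (πs s) ≤ vValue M (p (t + 1)) s :=
      (hg s (πs s)).trans (qValue_mono hk0 hk himp s _)
    have h2 := qValue_sub hk0 hk πs (p t) πs s
    have h3 := transMatrix_mulVec_mono M πs
      (f := fun z => vValue M πs z - vValue M (p t) z) (g := (1 - 1 / H) ^ t • h)
      (fun z => ih (by omega) z) s
    have h4 : h s = 1 + (transMatrix M πs *ᵥ h) s := congrFun hh s
    rw [mulVec_smul, Pi.smul_apply, smul_eq_mul] at h3
    have h5 : (transMatrix M πs *ᵥ h) s ≤ (1 - 1 / H) * h s := by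
      have : h s / H ≤ 1 := (div_le_one hH0).2 (hH s)
      have h6 : (1 - 1 / H) * h s = h s - h s / H := by ring
      linarith
    calc vValue M πs s - vValue M (p (t + 1)) s
        ≤ qValue M πs s (πs s) - qValue M (p t) s (πs s) := sub_le_sub_left h1 _
      _ ≤ (1 - 1 / H) ^ t * (transMatrix M πs *ᵥ h) s := h2 ▸ h3
      _ ≤ (1 - 1 / H) ^ t * ((1 - 1 / H) * h s) := by gcongr
      _ = (1 - 1 / H) ^ (t + 1) * h s := by ring

/-- Exact policy iteration is optimal after `L` steps as soon as `(1 - 1/H) ^ L * H` is below the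
gap `D` of the optimal action values: then the last greedy step cannot choose an action that is
suboptimal for them. -/
lemma policyIteration_isOptimal [Finite A] {πs : Policy σ A} (hopt : IsOptimal M πs) {H D : ℝ}
    (hkH : k / (1 - Real.exp (-1)) ≤ H)
    (hD : ∀ s b, ¬ IsMaxAction (qValue M πs) s b → D ≤ qValue M πs s (πs s) - qValue M πs s b)
    {p : ℕ → Policy σ A} {L : ℕ} (hp : ∀ t < L + 1, IsGreedy M (p t) (p (t + 1)))
    (hL : (1 - 1 / H) ^ (L + 1) * H < D) : IsOptimal M (p (L + 1)) := by
  obtain ⟨h, hpos, hle, hh⟩ := exists_expectedLength hk0 (hk πs)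
  have himp : ∀ s, qValue M πs s (πs s) ≤ qValue M πs s (p (L + 1) s) := by
    intro s
    have h1 : 1 ≤ H := by
      have h2 : h s = 1 + (transMatrix M πs *ᵥ h) s := congrFun hh s
      have h3 : 0 ≤ (transMatrix M πs *ᵥ h) s :=
        Finset.sum_nonneg fun z _ => mul_nonneg ENNReal.toReal_nonneg (hpos z)
      linarith [hle s]
    have hc : 0 ≤ 1 - 1 / H := by
      rw [sub_nonneg, div_le_one (by linarith)]
      exact h1
    have hH : ∀ s, h s ≤ H := fun s => (hle s).trans hkH
    have hcon := policyIteration_contraction hk0 hk hH h1 hh (L := L + 1) hp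
    by_contra hlt
    have hnot : ¬ IsMaxAction (qValue M πs) s (p (L + 1) s) := fun hm => hlt (hm (πs s))
    have hgap := hD s _ hnot
    have h2 := qValue_sub hk0 hk πs (p L) πs s
    have h3 := transMatrix_mulVec_mono M πs
      (f := fun z => vValue M πs z - vValue M (p L) z) (g := (1 - 1 / H) ^ L • h)
      (fun z => hcon L (by omega) z) s
    have h4 : h s = 1 + (transMatrix M πs *ᵥ h) s := congrFun hh s
    rw [mulVec_smul, Pi.smul_apply, smul_eq_mul] at h3
    have h5 : (transMatrix M πs *ᵥ h) s ≤ (1 - 1 / H) * H := by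
      have : (1 - 1 / H) * H = H - 1 := by field_simp
      linarith [hH s]
    have h6 : (1 - 1 / H) ^ L * (transMatrix M πs *ᵥ h) s ≤ (1 - 1 / H) ^ (L + 1) * H := by
      rw [pow_succ, mul_assoc]
      gcongr
    have h7 : qValue M (p L) s (πs s) ≤ qValue M (p L) s (p (L + 1) s) :=
      hp L (Nat.lt_succ_self L) s (πs s)
    have h8 : qValue M (p L) s (p (L + 1) s) ≤ qValue M πs s (p (L + 1) s) :=
      qValue_mono hk0 hk (fun z => hopt z (p L)) s _
    linarith
  intro s π'
  exact (hopt s π').trans (vValue_le_of_improvement hk0 hk himp s)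

end PolicyIteration

end MCES

/-! ### Moments of variables with exponential tails -/

namespace MCES

section Concentration

open Real

/-- The remainder of order two of the exponential series scales at least quadratically. -/
lemma exp_mul_sub_le {a y : ℝ} (ha : |a| ≤ 1) (hy : 0 ≤ y) :
    exp (a * y) - 1 - a * y ≤ a ^ 2 * (exp y - 1 - y) := by
  have hs : ∀ u : ℝ, HasSum (fun n : ℕ => u ^ (n + 2) / (n + 2).factorial) (exp u - 1 - u) := by
    intro u
    have h := NormedSpace.expSeries_div_hasSum_exp (𝔸 := ℝ) u
    rw [← Real.exp_eq_exp_ℝ] at h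
    have h2 := (hasSum_nat_add_iff' 2).2 h
    simpa [Finset.sum_range_succ, sub_sub] using h2
  refine hasSum_le (fun n => ?_) (hs (a * y)) ((hs y).mul_left (a ^ 2))
  rw [mul_pow, mul_div_assoc]
  refine mul_le_mul_of_nonneg_right ?_ (by positivity)
  calc a ^ (n + 2) ≤ |a| ^ (n + 2) := (le_abs_self _).trans_eq (abs_pow a _)
    _ ≤ |a| ^ 2 := pow_le_pow_of_le_one (abs_nonneg a) ha (by omega)
    _ = a ^ 2 := sq_abs a

variable {E : Type*} [MeasurableSpace E] {μ : Measure E} {Z : E → ℝ} {k : ℝ}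

/-- A sum of `c m` over the `m` with `m * k < Z` is integrated by means of the tails of `Z`. -/
lemma integral_sum_ceil_le (hZ : Measurable Z) (hk : 0 < k)
    (htail : ∀ m : ℕ, μ {x | m * k < Z x} ≤ ENNReal.ofReal (exp (-m)))
    {c : ℕ → ℝ} (hc : ∀ m, 0 ≤ c m) {S : ℝ} (hS : HasSum (fun m : ℕ => c m * exp (-m)) S) :
    Integrable (fun x => ∑ m ∈ Finset.range ⌈Z x / k⌉₊, c m) μ ∧
      ∫ x, ∑ m ∈ Finset.range ⌈Z x / k⌉₊, c m ∂μ ≤ S := by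
  have hA : ∀ m : ℕ, MeasurableSet {x | m * k < Z x} := fun m => measurableSet_lt (by fun_prop) hZ
  have hmeas : Measurable (fun x => ∑ m ∈ Finset.range ⌈Z x / k⌉₊, c m) :=
    (measurable_of_countable fun n : ℕ => ∑ m ∈ Finset.range n, c m).comp
      (Nat.measurable_ceil.comp (hZ.div_const k))
  have hpt : ∀ x, ENNReal.ofReal (∑ m ∈ Finset.range ⌈Z x / k⌉₊, c m) =
      ∑' m : ℕ, {x | m * k < Z x}.indicator (fun _ => ENNReal.ofReal (c m)) x := by
    intro x
    rw [ENNReal.ofReal_sum_of_nonneg fun m _ => hc m,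
      tsum_eq_sum (s := Finset.range ⌈Z x / k⌉₊)]
    · refine Finset.sum_congr rfl fun m hm => ?_
      rw [Finset.mem_range, Nat.lt_ceil, lt_div_iff₀ hk] at hm
      rw [Set.indicator_of_mem (s := {x | m * k < Z x}) hm]
    · intro m hm
      rw [Finset.mem_range, Nat.lt_ceil, lt_div_iff₀ hk] at hm
      rw [Set.indicator_of_notMem (s := {x | m * k < Z x}) hm]
  have hlint : ∫⁻ x, ENNReal.ofReal (∑ m ∈ Finset.range ⌈Z x / k⌉₊, c m) ∂μ ≤
      ENNReal.ofReal S := by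
    simp only [hpt]
    rw [lintegral_tsum fun m => (measurable_const.indicator (hA m)).aemeasurable, ← hS.tsum_eq,
      ENNReal.ofReal_tsum_of_nonneg (fun m => mul_nonneg (hc m) (exp_pos _).le) hS.summable]
    refine ENNReal.tsum_le_tsum fun m => ?_
    rw [lintegral_indicator_const (hA m), ENNReal.ofReal_mul (hc m)]
    gcongr
    exact htail m
  have hnn : ∀ x, 0 ≤ ∑ m ∈ Finset.range ⌈Z x / k⌉₊, c m := fun x =>
    Finset.sum_nonneg fun m _ => hc m
  have hint := (lintegral_ofReal_ne_top_iff_integrable hmeas.aestronglyMeasurable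
    (.of_forall hnn)).1 (hlint.trans_lt ENNReal.ofReal_lt_top).ne
  refine ⟨hint, ?_⟩
  rw [integral_eq_lintegral_of_nonneg_ae (.of_forall hnn) hmeas.aestronglyMeasurable]
  exact ENNReal.toReal_le_of_le_ofReal
    (hS.nonneg fun m => mul_nonneg (hc m) (exp_pos _).le) hlint

lemma integral_exp_ceil_le (hZ : Measurable Z) (hk : 0 < k)
    (htail : ∀ m : ℕ, μ {x | m * k < Z x} ≤ ENNReal.ofReal (exp (-m))) :
    Integrable (fun x => exp ((⌈Z x / k⌉₊ : ℝ) / 2) - 1) μ ∧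
      ∫ x, (exp ((⌈Z x / k⌉₊ : ℝ) / 2) - 1) ∂μ ≤ exp (1 / 2) := by
  have h1 : exp (-1 / 2) < 1 := exp_lt_one_iff.2 (by norm_num)
  have hS : HasSum (fun m : ℕ => (exp (((m + 1 : ℕ) : ℝ) / 2) - exp ((m : ℝ) / 2)) * exp (-m))
      (exp (1 / 2)) := by
    have h2 := (hasSum_geometric_of_lt_one (exp_pos (-1 / 2)).le h1).mul_left (exp (1 / 2) - 1)
    have h3 : (exp (1 / 2) - 1) * (1 - exp (-1 / 2))⁻¹ = exp (1 / 2) := by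
      have h4 : 1 - exp (-1 / 2) ≠ 0 := by linarith
      have h5 : exp (1 / 2) * exp (-1 / 2) = 1 := by
        rw [← exp_add]
        norm_num
      rw [← div_eq_mul_inv, div_eq_iff h4, mul_sub, h5, mul_one]
    rw [h3] at h2
    convert! h2 using 1
    funext m
    rw [← exp_nat_mul, sub_mul, sub_mul, ← exp_add, ← exp_add, ← exp_add, one_mul]
    push_cast
    ring_nf
  have h := integral_sum_ceil_le (μ := μ) hZ hk htail
    (c := fun m => exp (((m + 1 : ℕ) : ℝ) / 2) - exp ((m : ℝ) / 2)) (fun m => ?_) hS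
  · simp only [Finset.sum_range_sub fun m : ℕ => exp ((m : ℝ) / 2)] at h
    simpa using h
  · rw [sub_nonneg]
    gcongr
    exact Nat.le_succ m

lemma integral_sq_ceil_le (hZ : Measurable Z) (hk : 0 < k)
    (htail : ∀ m : ℕ, μ {x | m * k < Z x} ≤ ENNReal.ofReal (exp (-m))) :
    Integrable (fun x => ((⌈Z x / k⌉₊ - 1 : ℕ) : ℝ) ^ 2) μ ∧
      ∫ x, ((⌈Z x / k⌉₊ - 1 : ℕ) : ℝ) ^ 2 ∂μ ≤ 1.27 := by
  have h1 : exp (-1) < 1 := exp_lt_one_iff.2 (by norm_num)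
  have hS : HasSum (fun m : ℕ => (((m + 1 - 1 : ℕ) : ℝ) ^ 2 - ((m - 1 : ℕ) : ℝ) ^ 2) * exp (-m))
      (2 * (exp (-1) / (1 - exp (-1)) ^ 2) - (1 - exp (-1))⁻¹ + 1) := by
    have h2 := ((hasSum_coe_mul_geometric_of_norm_lt_one (r := exp (-1))
      (by rwa [norm_of_nonneg (exp_pos _).le])).mul_left 2).sub
      (hasSum_geometric_of_lt_one (exp_pos (-1)).le h1)
    have h3 := h2.add (hasSum_ite_eq 0 (1 : ℝ))
    convert! h3 using 1
    funext m
    have he : exp (-1) ^ m = exp (-m) := by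
      rw [← exp_nat_mul]
      ring_nf
    rw [he]
    rcases m with _ | m
    · simp
    · push_cast [Nat.add_sub_cancel]
      simp
      ring
  have hr : 2 * (exp (-1) / (1 - exp (-1)) ^ 2) - (1 - exp (-1))⁻¹ + 1 ≤ 1.27 := by
    have h2 : 0 < 1 - exp (-1) := by linarith
    have h3 : exp (-1) < 0.368 := by
      rw [exp_neg, inv_lt_comm₀ (exp_pos _) (by norm_num)]
      exact lt_trans (by norm_num) exp_one_gt_d9
    have h4 : 0 < exp (-1) := exp_pos _
    have h5 : 2 * (exp (-1) / (1 - exp (-1)) ^ 2) - (1 - exp (-1))⁻¹ + 1 =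
        (exp (-1) + exp (-1) ^ 2) / (1 - exp (-1)) ^ 2 := by
      field_simp
      ring
    rw [h5, div_le_iff₀ (by positivity)]
    nlinarith
  have h := integral_sum_ceil_le (μ := μ) hZ hk htail
    (c := fun m => ((m + 1 - 1 : ℕ) : ℝ) ^ 2 - ((m - 1 : ℕ) : ℝ) ^ 2) (fun m => ?_) hS
  · have h2 : ∀ n, ∑ m ∈ Finset.range n, (((m + 1 - 1 : ℕ) : ℝ) ^ 2 - ((m - 1 : ℕ) : ℝ) ^ 2) =
        ((n - 1 : ℕ) : ℝ) ^ 2 := fun n => by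
      rw [Finset.sum_range_sub fun m : ℕ => ((m - 1 : ℕ) : ℝ) ^ 2]
      simp
    simp only [h2] at h
    exact ⟨h.1, h.2.trans hr⟩
  · rw [sub_nonneg]
    gcongr
    omega

variable [IsProbabilityMeasure μ]

lemma memLp_and_variance_le (hZ : Measurable Z) (hk : 0 < k) (hZ0 : ∀ᵐ x ∂μ, 0 ≤ Z x)
    (htail : ∀ m : ℕ, μ {x | m * k < Z x} ≤ ENNReal.ofReal (exp (-m))) :
    MemLp Z 2 μ ∧ variance Z μ ≤ 2.27 * k ^ 2 := by
  obtain ⟨hi, hle⟩ := integral_sq_ceil_le (μ := μ) hZ hk htail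
  have hpt : ∀ᵐ x ∂μ, (Z x - k) ^ 2 ≤ k ^ 2 * (1 + ((⌈Z x / k⌉₊ - 1 : ℕ) : ℝ) ^ 2) := by
    filter_upwards [hZ0] with x hx
    rcases le_or_gt (Z x) k with h | h
    · have h1 : (Z x - k) ^ 2 ≤ k ^ 2 := by nlinarith
      nlinarith [sq_nonneg (k * ((⌈Z x / k⌉₊ - 1 : ℕ) : ℝ))]
    · have hJ : 1 ≤ ⌈Z x / k⌉₊ := Nat.one_le_ceil_iff.2 (div_pos (hk.trans h) hk)
      have h1 : Z x - k ≤ k * ((⌈Z x / k⌉₊ - 1 : ℕ) : ℝ) := by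
        rw [Nat.cast_sub hJ, Nat.cast_one]
        have := Nat.le_ceil (Z x / k)
        rw [div_le_iff₀ hk] at this
        linarith
      have h2 : (Z x - k) ^ 2 ≤ (k * ((⌈Z x / k⌉₊ - 1 : ℕ) : ℝ)) ^ 2 :=
        pow_le_pow_left₀ (by linarith) h1 2
      nlinarith [sq_nonneg k]
  have hbi : Integrable (fun x => k ^ 2 * (1 + ((⌈Z x / k⌉₊ - 1 : ℕ) : ℝ) ^ 2)) μ :=
    ((integrable_const 1).add hi).const_mul _
  have hm : AEStronglyMeasurable (fun x => Z x - k) μ := (hZ.sub_const k).aestronglyMeasurable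
  have hsq : Integrable (fun x => (Z x - k) ^ 2) μ := by
    refine hbi.mono' (hm.pow 2) ?_
    filter_upwards [hpt] with x hx
    rwa [norm_of_nonneg (sq_nonneg _)]
  have hLp : MemLp (fun x => Z x - k) 2 μ := (memLp_two_iff_integrable_sq hm).2 hsq
  refine ⟨by simpa [Pi.add_def] using hLp.add (memLp_const k), ?_⟩
  rw [← variance_sub_const hZ.aestronglyMeasurable k]
  refine (variance_le_expectation_sq hm).trans ?_
  calc ∫ x, (Z x - k) ^ 2 ∂μ ≤ ∫ x, k ^ 2 * (1 + ((⌈Z x / k⌉₊ - 1 : ℕ) : ℝ) ^ 2) ∂μ :=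
        integral_mono_ae hsq hbi hpt
    _ = k ^ 2 * (1 + ∫ x, ((⌈Z x / k⌉₊ - 1 : ℕ) : ℝ) ^ 2 ∂μ) := by
        rw [integral_const_mul, integral_add (integrable_const 1) hi]
        simp
    _ ≤ 2.27 * k ^ 2 := by nlinarith [sq_nonneg k]

/-- The moment generating function of the centred variable. Centring comes last: by
`1 + u ≤ exp u` only the second-order remainder of `exp (l * Z)` for the nonnegative variable `Z`
is needed. -/
lemma mgf_sub_integral_le (hZ : Measurable Z) (hk : 0 < k) (hZ0 : ∀ᵐ x ∂μ, 0 ≤ Z x)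
    (htail : ∀ m : ℕ, μ {x | m * k < Z x} ≤ ENNReal.ofReal (exp (-m)))
    {l : ℝ} (hl : |l| * (2 * k) ≤ 1) :
    Integrable (fun x => exp (l * (Z x - ∫ x, Z x ∂μ))) μ ∧
      mgf (fun x => Z x - ∫ x, Z x ∂μ) μ l ≤ exp (8 * (l * k) ^ 2) := by
  obtain ⟨hi, hle⟩ := integral_exp_ceil_le (μ := μ) hZ hk htail
  have hZi : Integrable Z μ := (memLp_and_variance_le hZ hk hZ0 htail).1.integrable one_le_two
  have hy : ∀ x, Z x / (2 * k) ≤ (⌈Z x / k⌉₊ : ℝ) / 2 := by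
    intro x
    have := Nat.le_ceil (Z x / k)
    have h2 : Z x / (2 * k) = Z x / k / 2 := by
      field_simp
    rw [h2]
    linarith
  have hpt : ∀ᵐ x ∂μ, exp (l * Z x) - 1 - l * Z x ≤
      (2 * (l * k)) ^ 2 * (exp ((⌈Z x / k⌉₊ : ℝ) / 2) - 1) := by
    filter_upwards [hZ0] with x hx
    have ha : |2 * (l * k)| ≤ 1 := by
      rw [abs_mul, abs_mul, abs_of_pos hk, abs_two]
      linarith
    have h1 := exp_mul_sub_le ha (y := Z x / (2 * k)) (by positivity)
    have h2 : 2 * (l * k) * (Z x / (2 * k)) = l * Z x := by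
      field_simp
    rw [h2] at h1
    refine h1.trans (mul_le_mul_of_nonneg_left ?_ (sq_nonneg _))
    have h3 := exp_le_exp.2 (hy x)
    have h4 : 0 ≤ Z x / (2 * k) := by positivity
    linarith
  have hexpi : Integrable (fun x => exp (l * Z x)) μ := by
    have hm : AEStronglyMeasurable (fun x => exp (l * Z x)) μ :=
      (hZ.const_mul l).exp.aestronglyMeasurable
    refine ((hi.const_mul ((2 * (l * k)) ^ 2)).add
      ((hZi.const_mul l).add (integrable_const 1))).mono' hm ?_
    filter_upwards [hpt] with x hx
    rw [norm_of_nonneg (exp_pos _).le]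
    simp only [Pi.add_apply]
    linarith
  have hfac : ∀ x, exp (l * (Z x - ∫ x, Z x ∂μ)) =
      exp (-(l * ∫ x, Z x ∂μ)) * exp (l * Z x) := by
    intro x
    rw [← exp_add]
    ring_nf
  have hE : ∫ x, exp (l * Z x) ∂μ ≤ exp (l * ∫ x, Z x ∂μ + 8 * (l * k) ^ 2) := by
    have h1 : ∫ x, (exp (l * Z x) - 1 - l * Z x) ∂μ ≤
        ∫ x, (2 * (l * k)) ^ 2 * (exp ((⌈Z x / k⌉₊ : ℝ) / 2) - 1) ∂μ :=
      integral_mono_ae ((hexpi.sub (integrable_const 1)).sub (hZi.const_mul l))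
        (hi.const_mul _) hpt
    have h2 : ∫ x, (exp (l * Z x) - 1 - l * Z x) ∂μ =
        ∫ x, exp (l * Z x) ∂μ - 1 - l * ∫ x, Z x ∂μ := by
      rw [integral_sub (f := fun x => exp (l * Z x) - 1) (hexpi.sub (integrable_const 1))
        (hZi.const_mul l), integral_sub hexpi (integrable_const 1), integral_const_mul]
      simp
    rw [h2, integral_const_mul] at h1
    have h3 : exp (1 / 2) ≤ 2 := by
      have h4 : exp (1 / 2) ^ 2 = exp 1 := by
        rw [← exp_nat_mul]
        norm_num
      have h5 := exp_one_lt_d9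
      by_contra! h6
      nlinarith
    have h7 := add_one_le_exp (l * ∫ x, Z x ∂μ + 8 * (l * k) ^ 2)
    nlinarith [sq_nonneg (l * k)]
  refine ⟨by simpa only [hfac] using hexpi.const_mul _, ?_⟩
  unfold mgf
  simp only [hfac]
  rw [integral_const_mul]
  calc exp (-(l * ∫ x, Z x ∂μ)) * ∫ x, exp (l * Z x) ∂μ
      ≤ exp (-(l * ∫ x, Z x ∂μ)) * exp (l * ∫ x, Z x ∂μ + 8 * (l * k) ^ 2) := by gcongr
    _ = exp (8 * (l * k) ^ 2) := by
        rw [← exp_add]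
        ring_nf

end Concentration

end MCES

/-! ### Deviations of sample means -/

namespace MCES

section SampleMean

open Real

/-- After taking logarithms this says that the concave function `3 * log l - l` is at least a
constant on `[log 4, 4]`, so that only the two endpoints have to be checked. -/
lemma mul_exp_le_cube {l : ℝ} (h1 : log 4 ≤ l) (h2 : l ≤ 4) :
    2.27 / (2 * l ^ 3) ≤ 2 * exp (-l) := by
  have hlog4 : 1.386 < log 4 := by
    have : log 4 = 2 * log 2 := by
      rw [show (4 : ℝ) = 2 ^ 2 by norm_num, log_pow]
      norm_num
    have h := log_two_gt_d9
    linarith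
  have hl : 0 < l := by linarith
  have hend : ∀ u, 0 < u → 1.135 * exp u ≤ 2 * u ^ 3 → log (1.135 / 2) ≤ 3 * log u - u := by
    intro u hu h
    have h3 := log_le_log (by positivity) h
    rw [log_mul (by norm_num) (exp_pos u).ne', log_exp, log_mul (by norm_num) (by positivity),
      log_pow] at h3
    rw [log_div (by norm_num) (by norm_num)]
    push_cast at h3
    linarith
  have ha : log (1.135 / 2) ≤ 3 * log (log 4) - log 4 := by
    refine hend _ (by linarith) ?_
    rw [exp_log (by norm_num)]
    have : (1.386 : ℝ) ^ 3 ≤ log 4 ^ 3 := pow_le_pow_left₀ (by norm_num) hlog4.le 3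
    linarith
  have hb : log (1.135 / 2) ≤ 3 * log 4 - 4 := by
    refine hend _ (by norm_num) ?_
    have h3 : exp 4 = exp 1 ^ 4 := by
      rw [← exp_nat_mul]
      norm_num
    have h4 : exp 1 ^ 4 ≤ 2.72 ^ 4 :=
      pow_le_pow_left₀ (exp_pos 1).le (by linarith [exp_one_lt_d9]) 4
    rw [h3]
    linarith
  have hconc : ConcaveOn ℝ (Set.Ioi 0) fun u : ℝ => 3 * log u - u := by
    have h3 : ConcaveOn ℝ (Set.Ioi (0 : ℝ)) fun u : ℝ => 3 * log u := by
      simpa using strictConcaveOn_log_Ioi.concaveOn.smul (c := (3 : ℝ)) (by norm_num)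
    exact h3.sub (convexOn_id (convex_Ioi 0))
  have hmin := hconc.min_le_of_mem_Icc (x := log 4) (y := 4) (z := l) (Set.mem_Ioi.2 (by linarith))
    (Set.mem_Ioi.2 (by norm_num)) ⟨h1, h2⟩
  have hfin : log (1.135 / 2) ≤ 3 * log l - l := (le_min ha hb).trans hmin
  have h5 := exp_le_exp.2 hfin
  rw [exp_log (by norm_num), sub_eq_add_neg, exp_add, show 3 * log l = log (l ^ 3) by
    rw [log_pow]; norm_num, exp_log (by positivity)] at h5
  rw [div_le_iff₀ (by positivity)]
  nlinarith

variable {E : Type*} [MeasurableSpace E] {μ : Measure E} [IsProbabilityMeasure μ] {Z : E → ℝ}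
  {k K ε l : ℝ} {N : ℕ}

lemma integral_pi_eval {g : E → ℝ} (hg : Measurable g) (i : Fin N) :
    ∫ x, g (x i) ∂(Measure.pi fun _ : Fin N => μ) = ∫ y, g y ∂μ := by
  have hmp : MeasurePreserving (fun x : Fin N → E => x i) (Measure.pi fun _ => μ) μ :=
    measurePreserving_eval _ i
  have h := integral_map (μ := Measure.pi fun _ : Fin N => μ) hmp.measurable.aemeasurable
    hg.aestronglyMeasurable
  rw [hmp.map_eq] at h
  exact h.symm

lemma sum_sub_tail_le_of_le_four (hZ : Measurable Z) (hk : 0 < k) (hkK : k ≤ K)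
    (hZ0 : ∀ᵐ x ∂μ, 0 ≤ Z x)
    (htail : ∀ m : ℕ, μ {x | m * k < Z x} ≤ ENNReal.ofReal (exp (-m)))
    (hε : 0 < ε) (hl : log 4 ≤ l) (hl4 : l ≤ 4) (hN : 2 * K ^ 2 * l ^ 3 ≤ N * ε ^ 2) :
    (Measure.pi fun _ : Fin N => μ).real {x | N * ε ≤ |∑ i, (Z (x i) - ∫ y, Z y ∂μ)|} ≤
      2 * exp (-l) := by
  obtain ⟨hLp, hvar⟩ := memLp_and_variance_le hZ hk hZ0 htail
  have hl0 : 0 < l := (log_pos (by norm_num)).trans_le hl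
  have hK : 0 < K := hk.trans_le hkK
  have hN0 : 0 < (N : ℝ) := by
    by_contra! h
    have h2 : 0 < 2 * K ^ 2 * l ^ 3 := by positivity
    nlinarith [sq_nonneg ε]
  set ν := Measure.pi fun _ : Fin N => μ with hν
  have hmp : ∀ i : Fin N, MeasurePreserving (fun x : Fin N → E => x i) ν μ :=
    fun i => measurePreserving_eval _ i
  have hS : MemLp (∑ i : Fin N, fun x : Fin N → E => Z (x i)) 2 ν :=
    memLp_finsetSum' _ fun i _ => hLp.comp_measurePreserving (hmp i)
  have hSv : variance (∑ i : Fin N, fun x : Fin N → E => Z (x i)) ν = N * variance Z μ := by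
    rw [hν, variance_sum_pi fun _ => hLp]
    simp
  have hSE : ∫ x, (∑ i : Fin N, fun x : Fin N → E => Z (x i)) x ∂ν = N * ∫ y, Z y ∂μ := by
    simp only [Finset.sum_apply]
    rw [integral_finsetSum (f := fun (i : Fin N) (x : Fin N → E) => Z (x i)) _ fun i _ =>
      (hLp.comp_measurePreserving (hmp i)).integrable one_le_two]
    simp [hν, integral_pi_eval hZ]
  have hch := meas_ge_le_variance_div_sq hS (c := N * ε) (by positivity)
  rw [hSE, hSv] at hch
  have hset : {x : Fin N → E | N * ε ≤ |∑ i, (Z (x i) - ∫ y, Z y ∂μ)|} =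
      {x | N * ε ≤ |(∑ i : Fin N, fun x : Fin N → E => Z (x i)) x - N * ∫ y, Z y ∂μ|} := by
    ext x
    simp [Finset.sum_sub_distrib]
  have hnn : 0 ≤ N * variance Z μ / (N * ε) ^ 2 :=
    div_nonneg (mul_nonneg hN0.le (variance_nonneg _ _)) (sq_nonneg _)
  rw [hset]
  refine (ENNReal.toReal_le_of_le_ofReal hnn hch).trans ?_
  refine le_trans ?_ (mul_exp_le_cube hl hl4)
  have h1 : N * variance Z μ / (N * ε) ^ 2 = variance Z μ / (N * ε ^ 2) := by
    field_simp
  rw [h1]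
  calc variance Z μ / (N * ε ^ 2) ≤ 2.27 * K ^ 2 / (2 * K ^ 2 * l ^ 3) := by
        gcongr
        exact hvar.trans (by gcongr)
    _ = 2.27 / (2 * l ^ 3) := by
        field_simp

lemma sum_sub_tail_le_of_four_le (hZ : Measurable Z) (hk : 0 < k) (hkK : k ≤ K)
    (hZ0 : ∀ᵐ x ∂μ, 0 ≤ Z x)
    (htail : ∀ m : ℕ, μ {x | m * k < Z x} ≤ ENNReal.ofReal (exp (-m)))
    (hε : 0 < ε) (hεK : ε ≤ K) (hl4 : 4 ≤ l) (hN : 2 * K ^ 2 * l ^ 3 ≤ N * ε ^ 2) :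
    (Measure.pi fun _ : Fin N => μ).real {x | N * ε ≤ |∑ i, (Z (x i) - ∫ y, Z y ∂μ)|} ≤
      2 * exp (-l) := by
  have hK : 0 < K := hk.trans_le hkK
  set ν := Measure.pi fun _ : Fin N => μ with hν
  set Y : Fin N → (Fin N → E) → ℝ := fun i x => Z (x i) - ∫ y, Z y ∂μ with hY
  have hYm : ∀ i, Measurable (Y i) := fun i =>
    (hZ.comp (measurable_pi_apply i)).sub_const _
  have hind : iIndepFun Y ν :=
    iIndepFun_pi (X := fun _ y => Z y - ∫ y, Z y ∂μ) fun i => (hZ.sub_const _).aemeasurable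
  have hmp : ∀ i : Fin N, MeasurePreserving (fun x : Fin N → E => x i) ν μ :=
    fun i => measurePreserving_eval _ i
  -- The exponent that minimizes the Chernoff bound for the variance proxy `16 * K ^ 2`.
  set t : ℝ := ε / (16 * K ^ 2) with ht
  have ht0 : 0 ≤ t := by positivity
  have htk : t * (2 * k) ≤ 1 := by
    rw [ht, div_mul_eq_mul_div, div_le_one (by positivity)]
    nlinarith
  have hmgf : ∀ u : ℝ, |u| = t → Integrable (fun x => exp (u * (∑ i, Y i) x)) ν ∧
      mgf (∑ i, Y i) ν u ≤ exp (N * (8 * (t * k) ^ 2)) := by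
    intro u hu
    obtain ⟨hi, hle⟩ := mgf_sub_integral_le hZ hk hZ0 htail (l := u) (by rwa [hu])
    have husq : (u * k) ^ 2 = (t * k) ^ 2 := by rw [mul_pow, mul_pow, ← sq_abs u, hu]
    constructor
    · refine hind.integrable_exp_mul_sum hYm fun i _ => ?_
      exact (hmp i).integrable_comp_of_integrable hi
    · rw [hind.mgf_sum hYm]
      have : ∀ i, mgf (Y i) ν u = mgf (fun y => Z y - ∫ y, Z y ∂μ) μ u := by
        intro i
        exact integral_pi_eval ((hZ.sub_const _).const_mul u).exp i
      simp only [this, Finset.prod_const, Finset.card_univ, Fintype.card_fin]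
      rw [exp_nat_mul, ← husq]
      exact pow_le_pow_left₀ mgf_nonneg hle N
  have hexp : exp (-t * (N * ε)) * exp (N * (8 * (t * k) ^ 2)) ≤ exp (-l) := by
    rw [← exp_add, exp_le_exp]
    have h1 : (t * k) ^ 2 ≤ (t * K) ^ 2 := by gcongr
    have h2 : -t * (N * ε) + N * (8 * (t * K) ^ 2) = -(N * ε ^ 2) / (32 * K ^ 2) := by
      rw [ht]
      field_simp
      ring
    have h3 : -(N * ε ^ 2) / (32 * K ^ 2) ≤ -l := by
      rw [div_le_iff₀ (by positivity)]
      have h4 : l * 16 ≤ l ^ 3 := by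
        have h6 : 4 ^ 2 ≤ l ^ 2 := by gcongr
        nlinarith
      nlinarith [mul_le_mul_of_nonneg_left h4 (sq_nonneg K)]
    have h5 : (N : ℝ) * (8 * (t * k) ^ 2) ≤ N * (8 * (t * K) ^ 2) := by gcongr
    linarith
  have hup : ν.real {x | N * ε ≤ (∑ i, Y i) x} ≤ exp (-l) := by
    obtain ⟨hi, hle⟩ := hmgf t (abs_of_nonneg ht0)
    refine (measure_ge_le_exp_mul_mgf (N * ε) ht0 hi).trans (le_trans ?_ hexp)
    gcongr
  have hlow : ν.real {x | (∑ i, Y i) x ≤ -(N * ε)} ≤ exp (-l) := by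
    obtain ⟨hi, hle⟩ := hmgf (-t) (by rw [abs_neg, abs_of_nonneg ht0])
    refine (measure_le_le_exp_mul_mgf (-(N * ε)) (by linarith) hi).trans (le_trans ?_ hexp)
    rw [neg_neg, mul_neg, neg_mul]
    gcongr
  calc ν.real {x | N * ε ≤ |∑ i, (Z (x i) - ∫ y, Z y ∂μ)|}
      ≤ ν.real ({x | N * ε ≤ (∑ i, Y i) x} ∪ {x | (∑ i, Y i) x ≤ -(N * ε)}) := by
        refine measureReal_mono fun x hx => ?_
        rcases le_abs.1 (Set.mem_ofPred_eq ▸ hx) with h | h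
        · left
          simpa [hY] using h
        · right
          have : (∑ i, Y i) x = ∑ i, (Z (x i) - ∫ y, Z y ∂μ) := by simp [hY]
          change (∑ i, Y i) x ≤ -(N * ε)
          rw [this]
          linarith
    _ ≤ exp (-l) + exp (-l) := (measureReal_union_le _ _).trans (add_le_add hup hlow)
    _ = 2 * exp (-l) := by ring

/-- Deviations of the sample mean of a variable with exponential tails. For small `l` the
Chernoff bound is too weak and Chebyshev's inequality is used; for large `l` the third power of
`l` leaves room for a Chernoff bound with a crude variance proxy. -/
lemma sampleMean_tail_le (hZ : Measurable Z) (hk : 0 < k) (hkK : k ≤ K)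
    (hZ0 : ∀ᵐ x ∂μ, 0 ≤ Z x)
    (htail : ∀ m : ℕ, μ {x | m * k < Z x} ≤ ENNReal.ofReal (exp (-m)))
    (hε : 0 < ε) (hεK : ε ≤ K) (hl : log 4 ≤ l) (hN : 2 * K ^ 2 * l ^ 3 ≤ N * ε ^ 2) :
    (Measure.pi fun _ : Fin N => μ).real {x | N * ε ≤ |∑ i, (Z (x i) - ∫ y, Z y ∂μ)|} ≤
      2 * exp (-l) := by
  rcases le_total l 4 with h | h
  · exact sum_sub_tail_le_of_le_four hZ hk hkK hZ0 htail hε hl h hN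
  · exact sum_sub_tail_le_of_four_le hZ hk hkK hZ0 htail hε hεK h hN

end SampleMean

end MCES

/-! ### Accuracy of the estimates along a run -/

namespace MCES

variable {σ A : Type*}

section Estimate

lemma measurable_qEstimate [Finite σ] (M : EpisodicMDP σ A) {N : ℕ} (π : Policy σ A) (s : σ) (a : A) :
    Measurable fun b : Batch σ A N => qEstimate M π b s a := by
  refine Measurable.const_mul (Finset.measurable_fun_sum _ fun i _ => ?_) _
  refine (measurable_episodeReturn M π a).comp ?_
  exact (measurable_pi_apply i).comp ((measurable_pi_apply a).comp (measurable_pi_apply s))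

/-- The event that all estimates of a batch generated under `π` have an error below `ε`. -/
def accurate (M : EpisodicMDP σ A) (N : ℕ) (ε : ℝ) (π : Policy σ A) : Set (Batch σ A N) :=
  {b | ∀ s a, |qEstimate M π b s a - qValue M π s a| < ε}

/-- A greedy choice with respect to accurate estimates is greedy with respect to the true action
values, provided that the errors are below half of their gap `D`. -/
lemma isMaxAction_of_accurate [Finite A] {M : EpisodicMDP σ A} {N : ℕ} {π : Policy σ A} {D : ℝ}
    (hD : (D : EReal) ≤ gap (qValue M π)) {b : Batch σ A N} (hb : b ∈ accurate M N (D / 2) π)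
    {s : σ} {a : A} (ha : IsMaxAction (qEstimate M π b) s a) : IsMaxAction (qValue M π) s a := by
  by_contra hnot
  have : Nonempty A := ⟨a⟩
  obtain ⟨c, hc⟩ := exists_isMaxAction (qValue M π) s
  have h1 := EReal.coe_le_coe_iff.1 (hD.trans (gap_le hc hnot))
  have h2 := abs_lt.1 (hb s a)
  have h3 := abs_lt.1 (hb s c)
  have h4 := ha c
  linarith [h2.2, h3.1]

variable [Fintype σ] [Fintype A]

instance instIsProbabilityMeasureBatch (M : EpisodicMDP σ A) (N : ℕ) (π : Policy σ A) :
    IsProbabilityMeasure (batchLaw M N π) := by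
  unfold batchLaw; infer_instance

lemma measurableSet_accurate (M : EpisodicMDP σ A) (N : ℕ) (ε : ℝ) (π : Policy σ A) :
    MeasurableSet (accurate M N ε π) := by
  have : accurate M N ε π =
      ⋂ s, ⋂ a, {b | |qEstimate M π b s a - qValue M π s a| < ε} := by
    ext b
    simp [accurate]
  rw [this]
  refine .iInter fun s => .iInter fun a => measurableSet_lt ?_ measurable_const
  exact continuous_abs.measurable.comp ((measurable_qEstimate M π s a).sub_const _)

variable [DecidableEq σ] {M : EpisodicMDP σ A} {π : Policy σ A} {k N : ℕ} {K ε l : ℝ}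

lemma qEstimate_tail_le (hk0 : 0 < k) (hk : ∀ s, survival M π k s ≤ Real.exp (-1))
    (hkK : (k : ℝ) ≤ K) (hε : 0 < ε) (hεK : ε ≤ K) (hl : Real.log 4 ≤ l)
    (hN : 2 * K ^ 2 * l ^ 3 ≤ N * ε ^ 2) (s : σ) (a : A) :
    (batchLaw M N π).real {b | ε ≤ |qEstimate M π b s a - qValue M π s a|} ≤
      2 * Real.exp (-l) := by
  have hK : 0 < K := lt_of_lt_of_le (by exact_mod_cast hk0) hkK
  have hN0 : 0 < (N : ℝ) := by
    have hl0 : 0 < l := (Real.log_pos (by norm_num)).trans_le hl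
    by_contra! h
    have h2 : 0 < 2 * K ^ 2 * l ^ 3 := by positivity
    nlinarith [sq_nonneg ε]
  have hGm := measurable_episodeReturn M π a
  have hZ : Measurable fun x => episodeReturn M π a x - M.r s a := hGm.sub_const _
  have hZ0 := episodeReturn_sub_ae_nonneg hk s a
  have htail := episodeReturn_tail hk s a
  have hkr : (0 : ℝ) < k := by exact_mod_cast hk0
  have key := sampleMean_tail_le hZ hkr hkK hZ0 htail hε hεK hl hN
  have hG : Integrable (episodeReturn M π a) (episodeLaw M π s a) := by
    have h := (memLp_and_variance_le hZ hkr hZ0 htail).1.integrable one_le_two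
    simpa [Pi.add_def] using h.add (integrable_const (M.r s a))
  have hmean : ∫ x, (episodeReturn M π a x - M.r s a) ∂(episodeLaw M π s a) =
      qValue M π s a - M.r s a := by
    rw [integral_sub hG (integrable_const _)]
    simp [qValue]
  rw [hmean] at key
  simp only [sub_sub_sub_cancel_right] at key
  have hmp : MeasurePreserving (fun b : Batch σ A N => b s a) (batchLaw M N π)
      (Measure.pi fun _ : Fin N => episodeLaw M π s a) :=
    (measurePreserving_eval (fun a => Measure.pi fun _ : Fin N => episodeLaw M π s a) a).comp
      (measurePreserving_eval
        (fun s => Measure.pi fun a => Measure.pi fun _ : Fin N => episodeLaw M π s a) s)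
  have hset : {b : Batch σ A N | ε ≤ |qEstimate M π b s a - qValue M π s a|} =
      (fun b : Batch σ A N => b s a) ⁻¹'
        {x | N * ε ≤ |∑ i, (episodeReturn M π a (x i) - qValue M π s a)|} := by
    ext b
    have h1 : ∑ i, (episodeReturn M π a (b s a i) - qValue M π s a) =
        N * (qEstimate M π b s a - qValue M π s a) := by
      rw [Finset.sum_sub_distrib, qEstimate]
      simp only [Finset.sum_const, Finset.card_univ, Fintype.card_fin, nsmul_eq_mul]
      field_simp
    simp only [Set.mem_ofPred_eq, Set.mem_preimage, h1, abs_mul, abs_of_pos hN0]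
    exact (mul_le_mul_iff_right₀ hN0).symm
  have hms : MeasurableSet {x : Fin N → ℕ → Option σ |
      N * ε ≤ |∑ i, (episodeReturn M π a (x i) - qValue M π s a)|} := by
    refine measurableSet_le measurable_const (continuous_abs.measurable.comp ?_)
    exact Finset.measurable_fun_sum _ fun i _ =>
      (hGm.comp (measurable_pi_apply i)).sub_const _
  rw [hset, measureReal_def, hmp.measure_preimage hms.nullMeasurableSet]
  exact key

lemma batchLaw_accurate_ge (hk0 : 0 < k) (hk : ∀ s, survival M π k s ≤ Real.exp (-1))
    (hkK : (k : ℝ) ≤ K) (hε : 0 < ε) (hεK : ε ≤ K) (hl : Real.log 4 ≤ l)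
    (hN : 2 * K ^ 2 * l ^ 3 ≤ N * ε ^ 2) :
    1 - Fintype.card σ * Fintype.card A * (2 * Real.exp (-l)) ≤
      (batchLaw M N π).real (accurate M N ε π) := by
  have h1 : (batchLaw M N π).real (accurate M N ε π)ᶜ ≤
      Fintype.card σ * Fintype.card A * (2 * Real.exp (-l)) := by
    have hc : (accurate M N ε π)ᶜ =
        ⋃ p : σ × A, {b | ε ≤ |qEstimate M π b p.1 p.2 - qValue M π p.1 p.2|} := by
      ext b
      simp [accurate]
    rw [hc]
    refine (measureReal_iUnion_fintype_le _).trans ?_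
    refine (Finset.sum_le_card_nsmul _ _ _ fun p _ =>
      qEstimate_tail_le hk0 hk hkK hε hεK hl hN p.1 p.2).trans_eq ?_
    simp [Fintype.card_prod]
  rw [probReal_compl_eq_one_sub (measurableSet_accurate M N ε π)] at h1
  linarith

end Estimate

section Run

variable [Fintype σ] [Fintype A] {M : EpisodicMDP σ A} {L N : ℕ} {Ω : Type*}
  [mΩ : MeasurableSpace Ω] {P : Measure Ω} {ℱ : Filtration ℕ mΩ} {pol : ℕ → Ω → Policy σ A}
  {ep : ℕ → Ω → Batch σ A N}

/-- If under every policy the batch of episodes falls into a set of probability at least `ρ`, then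
this happens in all of the first `t` iterations with probability at least `ρ ^ t`. -/
lemma IsRun.pow_le_measure [IsProbabilityMeasure P] (hrun : IsRun M L N P ℱ pol ep)
    {G : Policy σ A → Set (Batch σ A N)} (hG : ∀ π, MeasurableSet (G π)) {ρ : ENNReal}
    (hρ : ∀ π, ρ ≤ batchLaw M N π (G π)) :
    ∀ t ≤ L, ρ ^ t ≤ P {ω | ∀ i < t, ep i ω ∈ G (pol i ω)} := by
  have hstep : ∀ i, {ω | ep i ω ∈ G (pol i ω)} = ⋃ π, {ω | pol i ω = π} ∩ ep i ⁻¹' G π := by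
    intro i
    ext ω
    simp
  have hmeas : ∀ t ≤ L, MeasurableSet[ℱ t] {ω | ∀ i < t, ep i ω ∈ G (pol i ω)} := by
    intro t ht
    have : {ω | ∀ i < t, ep i ω ∈ G (pol i ω)} =
        ⋂ i ∈ Set.Iio t, {ω | ep i ω ∈ G (pol i ω)} := by
      ext ω
      simp
    rw [this]
    refine MeasurableSet.biInter (Set.to_countable _) fun i hi => ?_
    have hit : i < t := hi
    rw [hstep]
    refine MeasurableSet.iUnion fun π => MeasurableSet.inter ?_ ?_
    · exact ℱ.mono hit.le _ (hrun.pol_measurable i (hit.le.trans ht) π)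
    · exact ℱ.mono hit _ (hrun.ep_measurable i (hit.trans_le ht) (hG π))
  intro t
  induction t with
  | zero => simp
  | succ t ih =>
    intro ht
    set H := {ω | ∀ i < t, ep i ω ∈ G (pol i ω)} with hH
    have hHm := hmeas t (by omega)
    have hpm : ∀ π, MeasurableSet {ω | pol t ω = π} := fun π =>
      ℱ.le t _ (hrun.pol_measurable t (by omega) π)
    have hem : ∀ π, MeasurableSet (ep t ⁻¹' G π) := fun π =>
      ℱ.le (t + 1) _ (hrun.ep_measurable t ht (hG π))
    have hset : {ω | ∀ i < t + 1, ep i ω ∈ G (pol i ω)} =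
        ⋃ π, (H ∩ {ω | pol t ω = π}) ∩ ep t ⁻¹' G π := by
      ext ω
      simp only [Nat.forall_lt_succ_right]
      simp [hH]
    have hHset : H = ⋃ π, H ∩ {ω | pol t ω = π} := by
      ext ω
      simp
    have hdisj : Pairwise (Function.onFun Disjoint fun π => H ∩ {ω | pol t ω = π}) := by
      intro π π' hne
      refine Set.disjoint_left.2 fun ω hω hω' => hne ?_
      exact (Eq.symm hω.2).trans hω'.2
    calc ρ ^ (t + 1) = ρ ^ t * ρ := pow_succ _ _
      _ ≤ P H * ρ := by gcongr; exact ih (by omega)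
      _ = ∑' π, P (H ∩ {ω | pol t ω = π}) * ρ := by
        rw [ENNReal.tsum_mul_right]
        congr 1
        conv_lhs => rw [hHset]
        rw [measure_iUnion hdisj fun π => (ℱ.le t _ hHm).inter (hpm π)]
      _ ≤ ∑' π, P ((H ∩ {ω | pol t ω = π}) ∩ ep t ⁻¹' G π) := by
        refine ENNReal.tsum_le_tsum fun π => ?_
        rw [hrun.ep_law t ht π H hHm _ (hG π)]
        gcongr
        exact hρ π
      _ = P {ω | ∀ i < t + 1, ep i ω ∈ G (pol i ω)} := by
        rw [hset, measure_iUnion]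
        · exact fun π π' hne => (hdisj hne).mono Set.inter_subset_left Set.inter_subset_left
        · exact fun π => ((ℱ.le t _ hHm).inter (hpm π)).inter (hem π)

end Run

end MCES

/-! ### Probability that the output is optimal -/

namespace MCES

lemma half_le_one_sub_exp : 1 / 2 ≤ 1 - Real.exp (-1) := by
  have h : Real.exp (-1) ≤ 1 / 2 := by
    rw [Real.exp_neg, inv_le_comm₀ (Real.exp_pos _) (by norm_num)]
    linarith [Real.exp_one_gt_d9]
  linarith

/-- After `L ≥ 2 * H * log (H / D)` steps a contraction by `1 - 1 / H` brings `H` below `D`. -/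
lemma pow_mul_lt_of_log_le {H D : ℝ} {L : ℕ} (hH : 1 ≤ H) (hD : 0 < D) (hDH : D < H)
    (hL : 2 * H * Real.log (H / D) ≤ L) : (1 - 1 / H) ^ L * H < D := by
  have hH0 : 0 < H := by linarith
  have hx : 0 < Real.log (H / D) := Real.log_pos ((one_lt_div hD).2 hDH)
  have h1 : 0 ≤ 1 - 1 / H := by
    rw [sub_nonneg, div_le_one hH0]
    exact hH
  have h2 : 1 - 1 / H ≤ Real.exp (-(1 / H)) := by
    linarith [Real.add_one_le_exp (-(1 / H))]
  have h3 : (1 - 1 / H) ^ L ≤ Real.exp (-(L / H)) := by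
    refine (pow_le_pow_left₀ h1 h2 L).trans_eq ?_
    rw [← Real.exp_nat_mul]
    congr 1
    ring
  have h4 : Real.exp (-(L / H)) < Real.exp (-Real.log (H / D)) := by
    rw [Real.exp_lt_exp, neg_lt_neg_iff, lt_div_iff₀ hH0]
    nlinarith [mul_pos hx hH0]
  rw [Real.exp_neg (Real.log _), Real.exp_log (div_pos hH0 hD), inv_div] at h4
  calc (1 - 1 / H) ^ L * H < D / H * H := by
        gcongr
        exact h3.trans_lt h4
    _ = D := div_mul_cancel₀ _ hH0.ne'

end MCES

open MCES

theorem theorem1 {σ A : Type*} [Fintype σ] [Fintype A] (M : MCES.EpisodicMDP σ A)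
    (hproper : ∀ π : MCES.Policy σ A, MCES.IsProper M π)
    (K : ℝ) (hK0 : 0 < K) (hK : (MCES.kBar M (1 - Real.exp (-1)) : ℝ) ≤ K)
    (hL : 1 ≤ MCES.lStar M K)
    (δ : ℝ) (hδ0 : 0 < δ) (hδ1 : δ < 1)
    {Ω : Type*} [mΩ : MeasurableSpace Ω] (P : Measure Ω) [IsProbabilityMeasure P]
    (ℱ : Filtration ℕ mΩ)
    (pol : ℕ → Ω → MCES.Policy σ A)
    (ep : ℕ → Ω → MCES.Batch σ A (MCES.numEpisodes M K δ))
    (hrun : MCES.IsRun M (MCES.lStar M K) (MCES.numEpisodes M K δ) P ℱ pol ep) :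
    ENNReal.ofReal (1 - δ) ≤ P {ω | MCES.IsOptimal M (pol (MCES.lStar M K) ω)} := by
  classical
  have hη := half_le_one_sub_exp
  have hη0 : 0 < 1 - Real.exp (-1) := by linarith
  have hLpos : 0 < 2 * K / (1 - Real.exp (-1)) *
      Real.log (K / ((1 - Real.exp (-1)) * (gapStar M).toReal)) := by
    have h : 0 < lStar M K := hL
    exact Nat.ceil_pos.1 h
  have hLle : 2 * K / (1 - Real.exp (-1)) *
      Real.log (K / ((1 - Real.exp (-1)) * (gapStar M).toReal)) ≤ lStar M K := Nat.le_ceil _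
  -- At an infinite gap `toReal` is `0` and `lStar` would be `0`.
  have hgap0 : (gapStar M).toReal ≠ 0 := by
    intro h
    rw [h] at hLpos
    simp at hLpos
  have hgaptop : gapStar M ≠ ⊤ := by
    intro h
    rw [h] at hgap0
    simp at hgap0
  obtain ⟨s, b, hb⟩ : ∃ s b, ¬ IsMaxAction (qStar M) s b := by
    by_contra! hall
    refine hgaptop (iInf_eq_top.2 fun s => iInf_eq_top.2 ?_)
    rintro ⟨b, hb⟩
    exact absurd (hall s b) hb
  have : Nonempty A := ⟨b⟩
  have : Nonempty σ := ⟨s⟩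
  set k := kBar M (1 - Real.exp (-1)) with hkdef
  have hk0 : 0 < k := kBar_pos hproper (fun _ => b) s
  have hk : ∀ (π : Policy σ A) (s : σ), survival M π k s ≤ Real.exp (-1) :=
    survival_kBar_le hproper
  -- The two gaps are positive real numbers `D ≤ Ds`.
  set Ds := (gapStar M).toReal with hDs
  set D := (gapMin M).toReal with hD
  have hgapStar_pos : 0 < gapStar M := gap_pos _
  have hgle : gapMin M ≤ gapStar M := gapMin_le_gapStar hk0 hk
  have hDscoe : (Ds : EReal) = gapStar M :=
    EReal.coe_toReal hgaptop (ne_bot_of_gt hgapStar_pos)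
  have hDcoe : (D : EReal) = gapMin M :=
    EReal.coe_toReal (ne_top_of_le_ne_top hgaptop hgle) (ne_bot_of_gt (gapMin_pos M))
  have hDs0 : 0 < Ds := by
    rw [← EReal.coe_pos, hDscoe]
    exact hgapStar_pos
  have hD0 : 0 < D := by
    rw [← EReal.coe_pos, hDcoe]
    exact gapMin_pos M
  have hDDs : D ≤ Ds := by
    rw [← EReal.coe_le_coe_iff, hDcoe, hDscoe]
    exact hgle
  -- `H` bounds the expected length of an episode; `1 ≤ lStar` makes it exceed the gap.
  set H := K / (1 - Real.exp (-1)) with hH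
  have hHD : K / ((1 - Real.exp (-1)) * Ds) = H / Ds := by rw [hH, div_div]
  have h2H : 2 * K / (1 - Real.exp (-1)) = 2 * H := by rw [hH, mul_div_assoc]
  rw [hHD, h2H] at hLpos hLle
  have hH0 : 0 < H := by positivity
  have hDsH : Ds < H := by
    have h1 : 0 < Real.log (H / Ds) := by
      by_contra! h
      nlinarith
    by_contra! h
    exact absurd (Real.log_nonpos (by positivity) ((div_le_one hDs0).2 h)) (not_le.2 h1)
  have hK1 : 1 ≤ K := le_trans (by exact_mod_cast hk0) hK
  have hKH : K ≤ H := by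
    rw [hH, le_div_iff₀ hη0]
    nlinarith [Real.exp_pos (-1)]
  have hHK : H ≤ 2 * K := by
    rw [hH, div_le_iff₀ hη0]
    nlinarith
  -- The confidence level `1 - ρ` of a single iteration.
  set ρ := (1 - δ) ^ (1 / (lStar M K : ℝ)) with hρ
  have hL0 : (0 : ℝ) < lStar M K := by exact_mod_cast hL
  have hρ0 : 0 < ρ := Real.rpow_pos_of_pos (by linarith) _
  have hρ1 : ρ < 1 := Real.rpow_lt_one (by linarith) (by linarith) (by positivity)
  have hρL : ρ ^ lStar M K = 1 - δ := by
    rw [hρ, one_div]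
    exact Real.rpow_inv_natCast_pow (by linarith) (by omega)
  have hcard : (2 : ℝ) ≤ Fintype.card σ * Fintype.card A := by
    have h1 : 1 ≤ Fintype.card σ := Fintype.card_pos
    have h2 : 1 < Fintype.card A := by
      unfold IsMaxAction at hb
      push Not at hb
      obtain ⟨c, hc⟩ := hb
      exact Fintype.one_lt_card_iff.2 ⟨b, c, fun h => lt_irrefl _ (h ▸ hc)⟩
    have h3 : 1 * 2 ≤ Fintype.card σ * Fintype.card A := Nat.mul_le_mul h1 h2
    exact_mod_cast h3
  set l := Real.log (2 * (Fintype.card σ : ℝ) * (Fintype.card A : ℝ) / (1 - ρ)) with hl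
  have harg : 4 ≤ 2 * (Fintype.card σ : ℝ) * (Fintype.card A : ℝ) / (1 - ρ) := by
    rw [le_div_iff₀ (by linarith)]
    nlinarith
  have hl4 : Real.log 4 ≤ l := Real.log_le_log (by norm_num) harg
  have hexpl : (Fintype.card σ : ℝ) * Fintype.card A * (2 * Real.exp (-l)) = 1 - ρ := by
    rw [hl, Real.exp_neg, Real.exp_log (by linarith), inv_div]
    have h1 : (Fintype.card σ : ℝ) ≠ 0 := by positivity
    have h2 : (Fintype.card A : ℝ) ≠ 0 := by positivity
    field_simp
  set N := numEpisodes M K δ with hNdef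
  have hN : 2 * K ^ 2 * l ^ 3 ≤ N * (D / 2) ^ 2 := by
    have h1 : 8 * K ^ 2 / D ^ 2 * l ^ 3 ≤ N := Nat.le_ceil _
    have h2 : 2 * K ^ 2 * l ^ 3 = 8 * K ^ 2 / D ^ 2 * l ^ 3 * (D / 2) ^ 2 := by
      field_simp
      ring
    rw [h2]
    gcongr
  have hacc : ∀ π, ENNReal.ofReal ρ ≤ batchLaw M N π (accurate M N (D / 2) π) := by
    intro π
    rw [← ofReal_measureReal]
    refine ENNReal.ofReal_le_ofReal ?_
    have := batchLaw_accurate_ge (N := N) hk0 (hk π) hK (half_pos hD0) (by linarith) hl4 hN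
    rw [hexpl] at this
    linarith
  have hmain := hrun.pow_le_measure (measurableSet_accurate M N (D / 2)) hacc (lStar M K) le_rfl
  rw [← ENNReal.ofReal_pow hρ0.le, hρL] at hmain
  refine hmain.trans (measure_mono fun ω hω => ?_)
  have hgreedy : ∀ t < lStar M K, IsGreedy M (pol t ω) (pol (t + 1) ω) := fun t ht s =>
    isMaxAction_of_accurate (hDcoe.trans_le (iInf_le _ _)) (hω t ht) (hrun.greedy t ht ω s)
  obtain ⟨πs, hopt⟩ := exists_isOptimal hk0 hk
  obtain ⟨L', hL'⟩ : ∃ L', lStar M K = L' + 1 := ⟨lStar M K - 1, by omega⟩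
  have hfin := pow_mul_lt_of_log_le (hK1.trans hKH) hDs0 hDsH hLle
  rw [hL'] at hfin hgreedy
  change IsOptimal M (pol (lStar M K) ω)
  rw [hL']
  refine policyIteration_isOptimal hk0 hk hopt (H := H) (D := Ds) (div_le_div_of_nonneg_right hK hη0.le) ?_
    (p := fun t => pol t ω) hgreedy hfin
  intro s b hb
  rw [← EReal.coe_le_coe_iff, hDscoe, gapStar, hopt.qStar_eq hk0 hk]
  exact gap_le (hopt.isGreedy_self hk0 hk s) hb

end
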